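/- Let $k$ be a field, let $A$ and $B$ be finite-dimensional $k$-algebras, and put $\Lambda=A\otimes_k B$. All modules are finitely generated, left modules unless said otherwise, and $D=\operatorname{Hom}_k(-,k)$. For a ring $R$, a finitely generated left $R$-module $G$ is called Gorenstein projective if there is an exact complex $P^\bullet:\ \cdots\to P^{i}\xrightarrow{d^i}P^{i+1}\xrightarrow{d^{i+1}}P^{i+2}\to\cdots$ ($i\in\mathbb Z$) of finitely generated projective left $R$-modules such that $G\cong\operatorname{Ker}d^1$ and the complex $\operatorname{Hom}_R(P^\bullet,R)$ is again exact. The full subcategory of Gorenstein projective $R$-modules is denoted by $R\text{-}\mathsf{Gproj}$. Let $\mathrm{Mon}(B,A)$ be the full subcategory of all finitely generated left $\Lambda$-modules $X$ such that $\operatorname{Tor}_i^{\Lambda}(A\otimes_k D(S),X)=0$ for all $i\ge 1$ and all simple left $B$-modules $S$, and let $\mathrm{Mon}(B,A\text{-}\mathsf{Gproj})$ be the full subcategory of those $X\in\mathrm{Mon}(B,A)$ for which the left $A$-module $(A\otimes_k V)\otimes_{\Lambda}X$ belongs to $A\text{-}\mathsf{Gproj}$ for every finitely generated right $B$-module $V$.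 Then $\mathrm{Mon}(B,A\text{-}\mathsf{Gproj})\subseteq\Lambda\text{-}\mathsf{Gproj}$; that is, every module in $\mathrm{Mon}(B,A\text{-}\mathsf{Gproj})$ is a Gorenstein projective $A\otimes_k B$-module. -/

import Mathlib

open scoped TensorProduct CategoryTheory

universe u

noncomputable section

namespace MonRep

section TensorOverRing

variable (S R : Type u) [Ring S] [Ring R]
variable (M : Type u) [AddCommGroup M] [Module S M] [Module Rᵐᵒᵖ M] [SMulCommClass S Rᵐᵒᵖ M]

/-- For an `S`-`R`-bimodule `M` and a left `R`-module `X`: the relations `m r ⊗ x - m ⊗ r x`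
in `M ⊗_ℤ X`. -/
def balancing (X : Type u) [AddCommGroup X] [Module R X] : Submodule S (M ⊗[ℤ] X) :=
  Submodule.span S
    {t | ∃ (m : M) (r : R) (x : X), t = (MulOpposite.op r • m) ⊗ₜ[ℤ] x - m ⊗ₜ[ℤ] (r • x)}

/-- The left `S`-module `M ⊗_R X`, for an `S`-`R`-bimodule `M` and a left `R`-module `X`
over a not necessarily commutative ring `R`. -/
abbrev TensorOver (X : Type u) [AddCommGroup X] [Module R X] : Type u :=
  (M ⊗[ℤ] X) ⧸ balancing S R M X

/-- The map `M ⊗_R f`. -/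
def TensorOver.map {X Y : Type u} [AddCommGroup X] [Module R X] [AddCommGroup Y] [Module R Y]
    (f : X →ₗ[R] Y) : TensorOver S R M X →ₗ[S] TensorOver S R M Y :=
  Submodule.mapQ _ _
    (TensorProduct.AlgebraTensorModule.map (LinearMap.id : M →ₗ[S] M)
      (f.toAddMonoidHom.toIntLinearMap))
    (by
      rw [balancing, Submodule.span_le]
      rintro _ ⟨m, r, x, rfl⟩
      refine Submodule.subset_span ⟨m, r, f x, ?_⟩
      simp)

set_option linter.unusedSectionVars false in
theorem TensorOver.map_mk_tmul {X Y : Type u} [AddCommGroup X] [Module R X]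
    [AddCommGroup Y] [Module R Y] (f : X →ₗ[R] Y) (m : M) (x : X) :
    TensorOver.map S R M f (Submodule.Quotient.mk (m ⊗ₜ[ℤ] x)) =
      Submodule.Quotient.mk (m ⊗ₜ[ℤ] f x) :=
  rfl

set_option linter.unusedSectionVars false in
theorem TensorOver.hom_ext {X : Type u} [AddCommGroup X] [Module R X]
    {N : Type u} [AddCommGroup N] [Module S N]
    {f g : TensorOver S R M X →ₗ[S] N}
    (h : ∀ m x, f (Submodule.Quotient.mk (m ⊗ₜ[ℤ] x)) = g (Submodule.Quotient.mk (m ⊗ₜ[ℤ] x))) :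
    f = g := by
  refine Submodule.linearMap_qext _ (LinearMap.ext fun t => ?_)
  induction t with
  | zero => simp
  | tmul m x => exact h m x
  | add a b ha hb => rw [map_add, map_add, ha, hb]

/-- The functor `M ⊗_R -` from left `R`-modules to left `S`-modules. -/
def tensorFunctor : ModuleCat.{u} R ⥤ ModuleCat.{u} S where
  obj X := ModuleCat.of S (TensorOver S R M X)
  map f := ModuleCat.ofHom (TensorOver.map S R M f.hom)
  map_id X := by
    ext : 1
    exact TensorOver.hom_ext S R M fun m x => rfl
  map_comp f g := by
    ext : 1
    exact TensorOver.hom_ext S R M fun m x => rfl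

instance : (tensorFunctor S R M).Additive where
  map_add {X Y f g} := by
    ext : 1
    refine TensorOver.hom_ext S R M fun m x => ?_
    change TensorOver.map S R M (f.hom + g.hom) (Submodule.Quotient.mk (m ⊗ₜ[ℤ] x)) =
      TensorOver.map S R M f.hom (Submodule.Quotient.mk (m ⊗ₜ[ℤ] x)) +
        TensorOver.map S R M g.hom (Submodule.Quotient.mk (m ⊗ₜ[ℤ] x))
    simp only [TensorOver.map_mk_tmul, LinearMap.add_apply, TensorProduct.tmul_add,
      Submodule.Quotient.mk_add]

/-- `Tor_i^R(M, -)`, the left derived functors of `M ⊗_R -`; for an `S`-`R`-bimodule `M` they take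
values in left `S`-modules. -/
def Tor (i : ℕ) : ModuleCat.{u} R ⥤ ModuleCat.{u} S :=
  (tensorFunctor S R M).leftDerived i

end TensorOverRing

section Bimodule

variable (k : Type u) [Field k]

/-- The vector space dual `D(S) = Hom_k(S, k)`, to be regarded as a right module. -/
def RightDual (S : Type u) [AddCommGroup S] [Module k S] : Type u := Module.Dual k S

namespace RightDual

variable (B : Type u) [Ring B] [Algebra k B]
variable (S : Type u) [AddCommGroup S] [Module k S] [Module B S] [IsScalarTower k B S]

instance : AddCommGroup (RightDual k S) := inferInstanceAs (AddCommGroup (Module.Dual k S))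

instance : Module k (RightDual k S) := inferInstanceAs (Module k (Module.Dual k S))

/-- The identification of `D(S)` with the dual vector space. -/
def equiv : RightDual k S ≃ₗ[k] Module.Dual k S := LinearEquiv.refl k (Module.Dual k S)

/-- The right `B`-action on `D(S)`: `(f b)(s) = f (b s)`. -/
instance : Module Bᵐᵒᵖ (RightDual k S) where
  smul b f := (equiv k S).symm ((equiv k S f).comp (Algebra.lsmul k k S b.unop))
  one_smul f := LinearMap.ext fun s => congrArg (equiv k S f) (one_smul B s)
  mul_smul b c f := LinearMap.ext fun s => congrArg (equiv k S f) (mul_smul c.unop b.unop s)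
  smul_zero _ := rfl
  smul_add _ _ _ := rfl
  add_smul b c f := LinearMap.ext fun s =>
    (congrArg (equiv k S f) (add_smul b.unop c.unop s)).trans (map_add (equiv k S f) _ _)
  zero_smul f := LinearMap.ext fun s =>
    (congrArg (equiv k S f) (zero_smul B s)).trans (map_zero (equiv k S f))

theorem smul_apply (b : B) (f : RightDual k S) (s : S) :
    equiv k S (MulOpposite.op b • f) s = equiv k S f (b • s) :=
  rfl

instance : IsScalarTower k Bᵐᵒᵖ (RightDual k S) where
  smul_assoc c b f := LinearMap.ext fun s =>
    (congrArg (equiv k S f) (smul_assoc c b.unop s)).trans (map_smul (equiv k S f) c _)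

end RightDual

variable (A : Type u) [Ring A] [Algebra k A]

/-- The vector space `A ⊗_k V`, for a right `B`-module `V`, to be regarded as an
`A`-`(A ⊗_k B)`-bimodule. -/
def Ind (V : Type u) [AddCommGroup V] [Module k V] : Type u := A ⊗[k] V

namespace Ind

variable (B : Type u) [Ring B] [Algebra k B]
variable (V : Type u) [AddCommGroup V] [Module k V]

instance : AddCommGroup (Ind k A V) := inferInstanceAs (AddCommGroup (A ⊗[k] V))

/-- The left `A`-action: `a' (a ⊗ v) = a' a ⊗ v`. -/
instance : Module A (Ind k A V) := inferInstanceAs (Module A (A ⊗[k] V))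

/-- The identification of the underlying left `A`-module with `A ⊗_k V`. -/
def equiv : Ind k A V ≃ₗ[A] A ⊗[k] V := LinearEquiv.refl A (A ⊗[k] V)

variable [Module Bᵐᵒᵖ V] [IsScalarTower k Bᵐᵒᵖ V]

/-- The right action of `A ⊗_k B` on `A ⊗_k V`, as an algebra homomorphism. -/
def rightAction : (A ⊗[k] B)ᵐᵒᵖ →ₐ[k] Module.End A (A ⊗[k] V) :=
  (Module.endTensorEndAlgHom (R := k) (S := k) (A := A) (M := A) (N := V)).comp
    ((Algebra.TensorProduct.map (AlgEquiv.moduleEndSelf k (A := A)).toAlgHom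
      (Algebra.lsmul k k V : Bᵐᵒᵖ →ₐ[k] Module.End k V)).comp
      (Algebra.TensorProduct.opAlgEquiv k k A B).symm.toAlgHom)

theorem rightAction_tmul (a a' : A) (b : B) (v : V) :
    rightAction k A B V (MulOpposite.op (a ⊗ₜ[k] b)) (a' ⊗ₜ[k] v) =
      (a' * a) ⊗ₜ[k] (MulOpposite.op b • v) := by
  simp [rightAction, Module.endTensorEndAlgHom_apply]

/-- The right `A ⊗_k B`-action: `(a' ⊗ v) (a ⊗ b) = a' a ⊗ v b`. -/
instance : Module (A ⊗[k] B)ᵐᵒᵖ (Ind k A V) :=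
  Module.compHom (A ⊗[k] V) (rightAction k A B V).toRingHom

theorem op_smul_tmul (a a' : A) (b : B) (v : V) :
    MulOpposite.op (a ⊗ₜ[k] b) • (equiv k A V).symm (a' ⊗ₜ[k] v) =
      (equiv k A V).symm ((a' * a) ⊗ₜ[k] (MulOpposite.op b • v)) :=
  rightAction_tmul k A B V a a' b v

instance : SMulCommClass A (A ⊗[k] B)ᵐᵒᵖ (Ind k A V) where
  smul_comm a r t := ((rightAction k A B V r).map_smul a t).symm

end Ind

end Bimodule

section Gorenstein

variable (R : Type u) [Ring R]

/-- A complete projective resolution of an `R`-module `G`: an exact complex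
`⋯ ⟶ P i ⟶ P (i + 1) ⟶ ⋯`, indexed by `ℤ`, of finitely generated projective left `R`-modules
which stays exact under `Hom_R(-, R)`, with `G` (isomorphic to) the kernel of `d 1`. -/
structure CompleteProjectiveResolution (G : Type u) [AddCommGroup G] [Module R G] where
  P : ℤ → ModuleCat.{u} R
  d : ∀ i : ℤ, P i →ₗ[R] P (i + 1)
  finite : ∀ i, Module.Finite R (P i)
  projective : ∀ i, Module.Projective R (P i)
  exact : ∀ i, Function.Exact (d i) (d (i + 1))
  hom_exact : ∀ i, Function.Exact
    (fun f : P (i + 1 + 1) →ₗ[R] R => f ∘ₗ d (i + 1)) (fun f : P (i + 1) →ₗ[R] R => f ∘ₗ d i)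
  iso : G ≃ₗ[R] LinearMap.ker (d 1)

/-- The full subcategory `R-Gproj` of (finitely generated) Gorenstein projective left
`R`-modules. -/
def Gproj : CategoryTheory.ObjectProperty (ModuleCat.{u} R) :=
  fun G => Nonempty (CompleteProjectiveResolution R G)

end Gorenstein

section Mon

variable (k A B : Type u) [Field k] [Ring A] [Algebra k A] [Ring B] [Algebra k B]

/-- The monomorphism category `Mon(B, A)`: the finitely generated left `A ⊗_k B`-modules `X` with
`Tor_i^{A ⊗ B}(A ⊗ D(S), X) = 0` for all `i ≥ 1` and all simple left `B`-modules `S`. -/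
def Mon : CategoryTheory.ObjectProperty (ModuleCat.{u} (A ⊗[k] B)) := fun X =>
  Module.Finite (A ⊗[k] B) X ∧
    ∀ (S : Type u) [AddCommGroup S] [Module k S] [Module B S] [IsScalarTower k B S]
      [IsSimpleModule B S] (i : ℕ), 1 ≤ i →
      CategoryTheory.Limits.IsZero ((Tor A (A ⊗[k] B) (Ind k A (RightDual k S)) i).obj X)

/-- `Mon(B, L)`, for a full subcategory `L` of left `A`-modules: the modules `X` in `Mon(B, A)` with
`(A ⊗ V) ⊗_{A ⊗ B} X` in `L` for all finitely generated right `B`-modules `V`. -/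
def MonOver (L : CategoryTheory.ObjectProperty (ModuleCat.{u} A)) :
    CategoryTheory.ObjectProperty (ModuleCat.{u} (A ⊗[k] B)) := fun X =>
  Mon k A B X ∧
    ∀ (V : Type u) [AddCommGroup V] [Module k V] [Module Bᵐᵒᵖ V] [IsScalarTower k Bᵐᵒᵖ V]
      [Module.Finite Bᵐᵒᵖ V],
      L ((tensorFunctor A (A ⊗[k] B) (Ind k A V)).obj X)

end Mon

end MonRep

end

/-! Write `V ⊗_B X` for the `A`-module `(A ⊗ V) ⊗_Λ X`. The hypotheses on `X` are used in the form
of `IsFlatGproj`: `X` is finitely generated, `- ⊗_B X` is exact on finite-dimensional right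
`B`-modules, and every such `V ⊗_B X` is Gorenstein projective over `A`. Exactness follows from the
vanishing of `Tor_1` against all `A ⊗ D(S)`: every simple right module is some `D(S)`, and induction
on the dimension passes to all `V` (`isFlat_of_mon`).

The link between `Λ` and `A` is the duality `Hom_Λ(X, Λ) ≅ Hom_A(D(B) ⊗_B X, A)`, which comes from
`Λ ≅ Hom_k(D(B), A)` (`evalMap_map_injective`, `exists_eq_evalMap_map`). Since `D(B) ⊗_B X` is
Gorenstein projective, maps into `Λ` extend along the kernel of any surjection onto `X`. The class
is closed under syzygies, so dimension shifting gives `Ext^i_Λ(X, Λ) = 0` for all `i ≥ 1`.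

For a coresolution, take a map `q : X → Λ^n` through which every map `X → Λ` factors. Each right
module `V` embeds in a power of `D(B)`, so flatness, Ext-vanishing over `A` and the duality show
that every map `V ⊗_B X → A` factors through `V ⊗ q` (`exists_factorization`). As `V ⊗_B X` is
torsionless, `V ⊗ q` is injective; hence `q` is injective and its cokernel is again flat. The
cokernel of `V ⊗ q` is Gorenstein projective by a dual Schanuel argument (`gproj_cosyzygy`). So the
class is closed under these cosyzygies, and `gproj_of_coresolution` splices them with a projective
resolution. -/

noncomputable section

namespace MonRep

/-! ### Tensor products over a noncommutative ring: right exactness and behaviour on projectives. -/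

namespace TensorOver

variable {S R : Type u} [Ring S] [Ring R]
variable {M : Type u} [AddCommGroup M] [Module S M] [Module Rᵐᵒᵖ M] [SMulCommClass S Rᵐᵒᵖ M]
variable {M' : Type u} [AddCommGroup M'] [Module S M'] [Module Rᵐᵒᵖ M'] [SMulCommClass S Rᵐᵒᵖ M']
variable {M'' : Type u} [AddCommGroup M''] [Module S M''] [Module Rᵐᵒᵖ M'']
  [SMulCommClass S Rᵐᵒᵖ M'']
variable {X Y Z : Type u} [AddCommGroup X] [Module R X] [AddCommGroup Y] [Module R Y]
  [AddCommGroup Z] [Module R Z]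

/-- The element `m ⊗ x` of `M ⊗_R X`. -/
def tmk (S R : Type u) [Ring S] [Ring R] {M : Type u} [AddCommGroup M] [Module S M]
    [Module Rᵐᵒᵖ M] [SMulCommClass S Rᵐᵒᵖ M] {X : Type u} [AddCommGroup X] [Module R X]
    (m : M) (x : X) : TensorOver S R M X :=
  Submodule.Quotient.mk (m ⊗ₜ[ℤ] x)

theorem induction_on {p : TensorOver S R M X → Prop} (z : TensorOver S R M X) (zero : p 0)
    (tmk : ∀ m x, p (tmk S R m x)) (add : ∀ a b, p a → p b → p (a + b)) : p z := by
  obtain ⟨t, rfl⟩ := Submodule.Quotient.mk_surjective _ z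
  induction t with
  | zero => exact zero
  | tmul m x => exact tmk m x
  | add a b ha hb => exact add _ _ ha hb

theorem tmk_add (m : M) (x y : X) : tmk S R m (x + y) = tmk S R m x + tmk S R m y := by
  simp only [tmk, TensorProduct.tmul_add, Submodule.Quotient.mk_add]

theorem add_tmk (m n : M) (x : X) : tmk S R (m + n) x = tmk S R m x + tmk S R n x := by
  simp only [tmk, TensorProduct.add_tmul, Submodule.Quotient.mk_add]

theorem smul_tmk (s : S) (m : M) (x : X) : s • tmk S R m x = tmk S R (s • m) x := rfl

theorem op_smul_tmk (m : M) (r : R) (x : X) :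
    tmk S R (MulOpposite.op r • m) x = tmk S R m (r • x) :=
  (Submodule.Quotient.eq _).2 (Submodule.subset_span ⟨m, r, x, rfl⟩)

/-- `m ⊗ x` as a biadditive map, linear in `m`. -/
def tmkHom (S R : Type u) [Ring S] [Ring R] {M : Type u} [AddCommGroup M] [Module S M]
    [Module Rᵐᵒᵖ M] [SMulCommClass S Rᵐᵒᵖ M] {X : Type u} [AddCommGroup X] [Module R X]
    (x : X) : M →ₗ[S] TensorOver S R M X where
  toFun m := tmk S R m x
  map_add' _ _ := add_tmk _ _ _
  map_smul' _ _ := rfl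

/-- `m ⊗ x` as an additive map in `x`. -/
def tmkAddHom (S R : Type u) [Ring S] [Ring R] {M : Type u} [AddCommGroup M]
    [Module S M] [Module Rᵐᵒᵖ M] [SMulCommClass S Rᵐᵒᵖ M] {X : Type u} [AddCommGroup X]
    [Module R X] (m : M) : X →+ TensorOver S R M X :=
  AddMonoidHom.mk' (tmk S R m) (tmk_add m)

theorem map_tmk (f : X →ₗ[R] Y) (m : M) (x : X) :
    map S R M f (tmk S R m x) = tmk S R m (f x) := rfl

theorem ext_tmk {N : Type u} [AddCommGroup N] [Module S N] {f g : TensorOver S R M X →ₗ[S] N}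
    (h : ∀ m x, f (tmk S R m x) = g (tmk S R m x)) : f = g :=
  hom_ext S R M h

/-- The linear map out of `M ⊗_R X` given by a balanced biadditive map. -/
def lift {N : Type u} [AddCommGroup N] [Module S N] (f : M →+ X →+ N)
    (hs : ∀ (s : S) m x, f (s • m) x = s • f m x)
    (hr : ∀ (r : R) m x, f (MulOpposite.op r • m) x = f m (r • x)) :
    TensorOver S R M X →ₗ[S] N :=
  (balancing S R M X).liftQ
    (TensorProduct.AlgebraTensorModule.lift
      { toFun := fun m => (f m).toIntLinearMap
        map_add' := fun m n => by ext x; simp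
        map_smul' := fun s m => by ext x; simp [hs] })
    (by
      rw [balancing, Submodule.span_le]
      rintro _ ⟨m, r, x, rfl⟩
      simp [hr])

theorem map_id_apply (z : TensorOver S R M X) : map S R M LinearMap.id z = z :=
  LinearMap.congr_fun (f := map S R M LinearMap.id) (g := LinearMap.id)
    (ext_tmk fun _ _ => rfl) z

theorem map_comp_apply (g : Y →ₗ[R] Z) (f : X →ₗ[R] Y) (z : TensorOver S R M X) :
    map S R M g (map S R M f z) = map S R M (g ∘ₗ f) z :=
  LinearMap.congr_fun (f := map S R M g ∘ₗ map S R M f) (g := map S R M (g ∘ₗ f))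
    (ext_tmk fun _ _ => rfl) z

theorem map_zero_apply (z : TensorOver S R M X) : map S R M (0 : X →ₗ[R] Y) z = 0 :=
  LinearMap.congr_fun (g := 0) (ext_tmk fun m _ => (tmkAddHom S R m).map_zero) z

theorem map_surjective {f : X →ₗ[R] Y} (hf : Function.Surjective f) :
    Function.Surjective (map S R M f) := fun z => by
  induction z using induction_on with
  | zero => exact ⟨0, map_zero _⟩
  | tmk m y => obtain ⟨x, rfl⟩ := hf y; exact ⟨tmk S R m x, rfl⟩
  | add a b ha hb =>
    obtain ⟨a, rfl⟩ := ha
    obtain ⟨b, rfl⟩ := hb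
    exact ⟨a + b, map_add _ _ _⟩

/-- Right exactness over `ℤ` descends to the balanced quotients because every balancing relation
over `Z` lifts along the surjection `g` to one over `Y`. -/
theorem map_exact {f : X →ₗ[R] Y} {g : Y →ₗ[R] Z} (hfg : Function.Exact f g)
    (hg : Function.Surjective g) : Function.Exact (map S R M f) (map S R M g) := by
  intro z
  constructor
  · intro hz
    obtain ⟨t, rfl⟩ := Submodule.Quotient.mk_surjective _ z
    have hle : balancing S R M Z ≤ (balancing S R M Y).map
        (TensorProduct.AlgebraTensorModule.map (LinearMap.id : M →ₗ[S] M)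
          g.toAddMonoidHom.toIntLinearMap) := by
      rw [balancing, Submodule.span_le]
      rintro _ ⟨m, r, x, rfl⟩
      obtain ⟨y, rfl⟩ := hg x
      exact ⟨_, Submodule.subset_span ⟨m, r, y, rfl⟩, by simp⟩
    obtain ⟨b, hb, hbt⟩ := hle ((Submodule.Quotient.mk_eq_zero _).1 hz)
    -- After correction by the lifted relation `b`, the element `t - b` dies already in `M ⊗_ℤ Z`.
    have := (lTensor_exact (R := ℤ) M (f := f.toAddMonoidHom.toIntLinearMap)
      (g := g.toAddMonoidHom.toIntLinearMap) hfg hg (t - b)).1 (by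
        rw [map_sub, sub_eq_zero]; exact hbt.symm)
    obtain ⟨w, hw⟩ := this
    refine ⟨Submodule.Quotient.mk w, ?_⟩
    refine (Submodule.Quotient.eq _).2 ?_
    have h2 : (TensorProduct.AlgebraTensorModule.map (LinearMap.id : M →ₗ[S] M)
      f.toAddMonoidHom.toIntLinearMap) w = t - b := hw
    rw [h2]
    simpa using hb
  · rintro ⟨w, rfl⟩
    rw [map_comp_apply, hfg.linearMap_comp_eq_zero, map_zero_apply]

/-- The map `f ⊗_R X`, for a homomorphism `f` of bimodules. -/
def mapLeft (X : Type u) [AddCommGroup X] [Module R X] (f : M →ₗ[S] M')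
    (hf : ∀ (r : Rᵐᵒᵖ) m, f (r • m) = r • f m) : TensorOver S R M X →ₗ[S] TensorOver S R M' X :=
  lift (AddMonoidHom.mk' (fun m => tmkAddHom S R (f m)) fun m n => by
      ext x; simp [tmkAddHom, add_tmk])
    (fun s m x => by simp [tmkAddHom, smul_tmk])
    (fun r m x => by simp [tmkAddHom, hf, op_smul_tmk])

theorem mapLeft_tmk (f : M →ₗ[S] M') (hf : ∀ (r : Rᵐᵒᵖ) m, f (r • m) = r • f m) (m : M) (x : X) :
    mapLeft X f hf (tmk S R m x) = tmk S R (f m) x := rfl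

theorem mapLeft_map (f : M →ₗ[S] M') (hf : ∀ (r : Rᵐᵒᵖ) m, f (r • m) = r • f m)
    (g : X →ₗ[R] Y) (z : TensorOver S R M X) :
    mapLeft Y f hf (map S R M g z) = map S R M' g (mapLeft X f hf z) :=
  LinearMap.congr_fun (f := mapLeft Y f hf ∘ₗ map S R M g) (g := map S R M' g ∘ₗ mapLeft X f hf)
    (ext_tmk fun _ _ => rfl) z

theorem mapLeft_surjective {f : M →ₗ[S] M'} (hf : ∀ (r : Rᵐᵒᵖ) m, f (r • m) = r • f m)
    (h : Function.Surjective f) : Function.Surjective (mapLeft X f hf) := fun z => by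
  induction z using induction_on with
  | zero => exact ⟨0, map_zero _⟩
  | tmk m x => obtain ⟨m, rfl⟩ := h m; exact ⟨tmk S R m x, rfl⟩
  | add a b ha hb =>
    obtain ⟨a, rfl⟩ := ha
    obtain ⟨b, rfl⟩ := hb
    exact ⟨a + b, map_add _ _ _⟩

/-- As in `map_exact`, with the balancing relations now lifted along `g` in the first variable. -/
theorem mapLeft_exact {f : M →ₗ[S] M'} (hf : ∀ (r : Rᵐᵒᵖ) m, f (r • m) = r • f m)
    {g : M' →ₗ[S] M''} (hg : ∀ (r : Rᵐᵒᵖ) m, g (r • m) = r • g m) (hfg : Function.Exact f g)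
    (hgs : Function.Surjective g) : Function.Exact (mapLeft X f hf) (mapLeft X g hg) := by
  intro z
  constructor
  · intro hz
    obtain ⟨t, rfl⟩ := Submodule.Quotient.mk_surjective _ z
    have hle : balancing S R M'' X ≤ (balancing S R M' X).map
        (TensorProduct.AlgebraTensorModule.map g (LinearMap.id : X →ₗ[ℤ] X)) := by
      rw [balancing, Submodule.span_le]
      rintro _ ⟨m, r, x, rfl⟩
      obtain ⟨m, rfl⟩ := hgs m
      exact ⟨_, Submodule.subset_span ⟨m, r, x, rfl⟩, by simp [hg]⟩
    have hrep : ∀ t : M' ⊗[ℤ] X, mapLeft X g hg (Submodule.Quotient.mk t) = Submodule.Quotient.mk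
        (TensorProduct.AlgebraTensorModule.map g (LinearMap.id : X →ₗ[ℤ] X) t) := fun t => by
      induction t with
      | zero => exact map_zero _
      | tmul m x => rfl
      | add a b ha hb => rw [Submodule.Quotient.mk_add, map_add, ha, hb, map_add]; rfl
    have hrep' : ∀ t : M ⊗[ℤ] X, mapLeft X f hf (Submodule.Quotient.mk t) = Submodule.Quotient.mk
        (TensorProduct.AlgebraTensorModule.map f (LinearMap.id : X →ₗ[ℤ] X) t) := fun t => by
      induction t with
      | zero => exact map_zero _
      | tmul m x => rfl
      | add a b ha hb => rw [Submodule.Quotient.mk_add, map_add, ha, hb, map_add]; rfl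
    rw [hrep] at hz
    obtain ⟨b, hb, hbt⟩ := hle ((Submodule.Quotient.mk_eq_zero _).1 hz)
    have := (rTensor_exact (R := ℤ) X (f := f.toAddMonoidHom.toIntLinearMap)
      (g := g.toAddMonoidHom.toIntLinearMap) hfg hgs (t - b)).1 (by
        rw [map_sub, sub_eq_zero]; exact hbt.symm)
    obtain ⟨w, hw⟩ := this
    refine ⟨Submodule.Quotient.mk w, ?_⟩
    rw [hrep']
    refine (Submodule.Quotient.eq _).2 ?_
    have h2 : (TensorProduct.AlgebraTensorModule.map f (LinearMap.id : X →ₗ[ℤ] X)) w = t - b := hw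
    rw [h2]
    simpa using hb
  · rintro ⟨w, rfl⟩
    induction w using induction_on with
    | zero => simp
    | tmk m x =>
      rw [mapLeft_tmk, mapLeft_tmk, hfg.apply_apply_eq_zero]
      exact (tmkHom S R x).map_zero
    | add a b ha hb => rw [map_add, map_add, ha, hb, add_zero]

/-- The map `M ⊗_R R^(ι) ⟶ M^(ι)`. -/
def toFinsupp (S R M : Type u) [Ring S] [Ring R] [AddCommGroup M] [Module S M] [Module Rᵐᵒᵖ M]
    [SMulCommClass S Rᵐᵒᵖ M] (ι : Type u) : TensorOver S R M (ι →₀ R) →ₗ[S] (ι →₀ M) :=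
  lift (AddMonoidHom.mk' (fun m => Finsupp.mapRange.addMonoidHom
        (AddMonoidHom.mk' (fun r : R => MulOpposite.op r • m) fun r s => by
          rw [MulOpposite.op_add, add_smul])) fun m n => by
        ext i r j; simp)
    (fun s m x => by ext i; simp [smul_comm])
    (fun r m x => by ext i; simp [mul_smul])

theorem toFinsupp_tmk (ι : Type u) (m : M) (x : ι →₀ R) (i : ι) :
    toFinsupp S R M ι (tmk S R m x) i = MulOpposite.op (x i) • m := rfl

/-- `M ⊗_R R^(ι) ≅ M^(ι)`. -/
def finsuppEquiv (ι : Type u) : TensorOver S R M (ι →₀ R) ≃ₗ[S] (ι →₀ M) :=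
  LinearEquiv.ofLinearMap (toFinsupp S R M ι)
    (Finsupp.lsum ℕ fun i => tmkHom S R (Finsupp.single i (1 : R)))
    (by
      classical
      refine Finsupp.lhom_ext fun i m => Finsupp.ext fun j => ?_
      rw [LinearMap.comp_apply, Finsupp.lsum_single]
      refine (toFinsupp_tmk ι m (Finsupp.single i (1 : R)) j).trans ?_
      rw [LinearMap.id_apply, Finsupp.single_apply, Finsupp.single_apply]
      split_ifs <;> simp)
    (by
      classical
      refine ext_tmk fun m x => ?_
      rw [LinearMap.comp_apply]
      induction x using Finsupp.induction_linear with
      | zero =>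
        have : tmk S R m (0 : ι →₀ R) = 0 := (tmkAddHom S R m).map_zero
        rw [this, map_zero, map_zero, map_zero]
      | add x y hx hy =>
        rw [tmk_add, map_add, map_add, hx, hy, map_add]
      | single i r =>
        have : toFinsupp S R M ι (tmk S R m (Finsupp.single i r)) =
            Finsupp.single i (MulOpposite.op r • m) := by
          ext j
          rw [toFinsupp_tmk, Finsupp.single_apply, Finsupp.single_apply]
          split_ifs <;> simp
        rw [this, Finsupp.lsum_single]
        refine (op_smul_tmk _ _ _).trans ?_
        rw [Finsupp.smul_single, smul_eq_mul, mul_one, LinearMap.id_apply])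

theorem finsuppEquiv_tmk (ι : Type u) (m : M) (x : ι →₀ R) (i : ι) :
    finsuppEquiv (S := S) ι (tmk S R m x) i = MulOpposite.op (x i) • m := rfl

theorem finsuppEquiv_mapLeft (ι : Type u) (f : M →ₗ[S] M')
    (hf : ∀ (r : Rᵐᵒᵖ) m, f (r • m) = r • f m) (z : TensorOver S R M (ι →₀ R)) (i : ι) :
    finsuppEquiv ι (mapLeft _ f hf z) i = f (finsuppEquiv ι z i) := by
  induction z using induction_on with
  | zero => simp
  | tmk m x => rw [mapLeft_tmk, finsuppEquiv_tmk, finsuppEquiv_tmk, hf]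
  | add a b ha hb => simp only [map_add, Finsupp.add_apply, ha, hb]

/-- `X` is a retract of the free module `R^(X)`, and on free modules tensoring `f` amounts to
applying `f` coordinatewise. -/
theorem mapLeft_injective_of_projective [Module.Projective R X] {f : M →ₗ[S] M'}
    (hf : ∀ (r : Rᵐᵒᵖ) m, f (r • m) = r • f m) (h : Function.Injective f) :
    Function.Injective (mapLeft X f hf) := by
  obtain ⟨s, hs⟩ := Module.projective_def'.1 ‹Module.Projective R X›
  rw [injective_iff_map_eq_zero]
  intro z hz
  have h1 : map S R M s z = 0 := by
    apply (finsuppEquiv X).injective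
    ext i
    apply h
    rw [← finsuppEquiv_mapLeft X f hf, mapLeft_map, hz]
    simp
  rw [← map_id_apply z, ← hs, ← map_comp_apply, h1, map_zero]

theorem projective_of_projective [Module.Projective R X] [Module.Free S M] :
    Module.Projective S (TensorOver S R M X) := by
  obtain ⟨s, hs⟩ := Module.projective_def'.1 ‹Module.Projective R X›
  have : Module.Projective S (TensorOver S R M (X →₀ R)) :=
    Module.Projective.of_equiv (finsuppEquiv (S := S) (R := R) (M := M) X).symm
  refine Module.Projective.of_split (map S R M s)
    (map S R M (Finsupp.linearCombination R id)) (LinearMap.ext fun z => ?_)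
  rw [LinearMap.comp_apply, map_comp_apply, hs]
  exact map_id_apply z

theorem finite [Module.Finite R X] [Module.Finite S M] :
    Module.Finite S (TensorOver S R M X) := by
  obtain ⟨n, f, hf⟩ := Module.Finite.exists_fin' R X
  -- The index type in `finsuppEquiv` must lie in universe `u`, hence the lift of `Fin n`.
  let e := Finsupp.domLCongr (M := R) (R := R) (Equiv.ulift.{u} : ULift.{u} (Fin n) ≃ Fin n) ≪≫ₗ
    Finsupp.linearEquivFunOnFinite R R (Fin n)
  exact Module.Finite.of_surjective
    (map S R M (f ∘ₗ e.toLinearMap) ∘ₗ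
      (finsuppEquiv (S := S) (R := R) (M := M) (ULift.{u} (Fin n))).symm.toLinearMap)
    ((map_surjective (f := f ∘ₗ e.toLinearMap) (hf.comp e.surjective)).comp (LinearEquiv.surjective _))

end TensorOver

/-! ### Gorenstein projective modules: Ext-vanishing, construction from coresolutions, closure
properties. -/

section GorensteinProjective

open CategoryTheory Abelian

variable {R : Type u} [Ring R]

variable (R) in
/-- The modules `G` with `Ext^i(G, R) = 0` for all `i ≥ 1`. -/
def ExtVanishing (G : Type u) [AddCommGroup G] [Module R G] : Prop :=
  ∀ n : ℕ, Subsingleton (Ext.{u} (ModuleCat.of R G) (ModuleCat.of R R) (n + 1))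

variable {K P G H : Type u} [AddCommGroup K] [Module R K] [AddCommGroup P] [Module R P]
  [AddCommGroup G] [Module R G] [AddCommGroup H] [Module R H]

/-- The short complex in `ModuleCat R` given by an exact pair of linear maps. -/
abbrev exactComplex (f : K →ₗ[R] P) (g : P →ₗ[R] G) (h : Function.Exact f g) :
    ShortComplex (ModuleCat.{u} R) :=
  ShortComplex.mk (ModuleCat.ofHom f) (ModuleCat.ofHom g) (by
    ext x; exact h.apply_apply_eq_zero x)

theorem exactComplex_shortExact {f : K →ₗ[R] P} {g : P →ₗ[R] G} (hf : Function.Injective f)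
    (h : Function.Exact f g) (hg : Function.Surjective g) : (exactComplex f g h).ShortExact where
  exact := (ShortComplex.ShortExact.moduleCat_exact_iff_function_exact _).2 h
  mono_f := (ModuleCat.mono_iff_injective _).2 hf
  epi_g := (ModuleCat.epi_iff_surjective _).2 hg

theorem exists_extension_of_ext_one
    (h1 : Subsingleton (Ext.{u} (ModuleCat.of R G) (ModuleCat.of R R) 1))
    {f : K →ₗ[R] P} {g : P →ₗ[R] G} (hf : Function.Injective f)
    (h : Function.Exact f g) (hg : Function.Surjective g) (φ : K →ₗ[R] R) :
    ∃ ψ : P →ₗ[R] R, ψ ∘ₗ f = φ := by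
  obtain ⟨y, hy⟩ := Ext.contravariant_sequence_exact₁ (exactComplex_shortExact hf h hg)
    (ModuleCat.of R R) (Ext.mk₀ (ModuleCat.ofHom φ)) (n₁ := 1) rfl (Subsingleton.elim _ _)
  obtain ⟨ψ, rfl⟩ := (Ext.mk₀_bijective _ _).2 y
  rw [Ext.mk₀_comp_mk₀] at hy
  exact ⟨ψ.hom, congrArg ModuleCat.Hom.hom ((Ext.mk₀_bijective _ _).1 hy)⟩

/-- Since `Ext^1(P, R) = 0`, each class in `Ext^1(G, R)` is the connecting image of some map `K →
R`; if that map extends to `P`, its image is zero. -/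
theorem ext_one_of_exists_extension [Module.Projective R P]
    {f : K →ₗ[R] P} {g : P →ₗ[R] G} (hf : Function.Injective f)
    (h : Function.Exact f g) (hg : Function.Surjective g)
    (hext : ∀ φ : K →ₗ[R] R, ∃ ψ : P →ₗ[R] R, ψ ∘ₗ f = φ) :
    Subsingleton (Ext.{u} (ModuleCat.of R G) (ModuleCat.of R R) 1) := by
  refine subsingleton_of_forall_eq 0 fun x => ?_
  have : Projective (ModuleCat.of R P) := (IsProjective.iff_projective P).1 inferInstance
  have hS := exactComplex_shortExact hf h hg
  obtain ⟨y, rfl⟩ := Ext.contravariant_sequence_exact₃ hS _ x (Ext.eq_zero_of_projective _)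
    (n₀ := 0) rfl
  obtain ⟨φ, rfl⟩ := (Ext.mk₀_bijective _ _).2 y
  obtain ⟨ψ, hψ⟩ := hext φ.hom
  have : φ = (exactComplex f g h).f ≫ ModuleCat.ofHom ψ := by
    ext x; exact (LinearMap.congr_fun hψ x).symm
  rw [this, ← Ext.mk₀_comp_mk₀, hS.extClass_comp_assoc]

theorem ext_succ_of_syzygy [Module.Projective R P]
    {f : K →ₗ[R] P} {g : P →ₗ[R] G} (hf : Function.Injective f)
    (h : Function.Exact f g) (hg : Function.Surjective g) {n : ℕ}
    (hK : Subsingleton (Ext.{u} (ModuleCat.of R K) (ModuleCat.of R R) n)) :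
    Subsingleton (Ext.{u} (ModuleCat.of R G) (ModuleCat.of R R) (n + 1)) := by
  refine subsingleton_of_forall_eq 0 fun x => ?_
  have : Projective (ModuleCat.of R P) := (IsProjective.iff_projective P).1 inferInstance
  obtain ⟨y, rfl⟩ := Ext.contravariant_sequence_exact₃ (exactComplex_shortExact hf h hg) _ x
    (Ext.eq_zero_of_projective _) (add_comm 1 n)
  rw [Subsingleton.elim y 0, Ext.comp_zero]

theorem ExtVanishing.syzygy [Module.Projective R P] (hG : ExtVanishing R G)
    {f : K →ₗ[R] P} {g : P →ₗ[R] G} (hf : Function.Injective f)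
    (h : Function.Exact f g) (hg : Function.Surjective g) : ExtVanishing R K := fun n => by
  refine subsingleton_of_forall_eq 0 fun x => ?_
  have : Projective (ModuleCat.of R P) := (IsProjective.iff_projective P).1 inferInstance
  have := hG (n + 1)
  obtain ⟨y, rfl⟩ := Ext.contravariant_sequence_exact₁ (exactComplex_shortExact hf h hg)
    (ModuleCat.of R R) x (add_comm 1 (n + 1)) (Subsingleton.elim _ _)
  rw [Ext.eq_zero_of_projective (P := ModuleCat.of R P) y, Ext.comp_zero]

theorem ExtVanishing.retract (hG : ExtVanishing R G) (i : H →ₗ[R] G) (p : G →ₗ[R] H)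
    (hpi : p ∘ₗ i = LinearMap.id) : ExtVanishing R H := fun n => by
  refine subsingleton_of_forall_eq 0 fun x => ?_
  have hx : (Ext.mk₀ (ModuleCat.ofHom i)).comp ((Ext.mk₀ (ModuleCat.ofHom p)).comp x
      (zero_add _)) (zero_add _) = x := by
    rw [Ext.mk₀_comp_mk₀_assoc, ← ModuleCat.ofHom_comp, hpi]
    exact Ext.mk₀_id_comp _
  have := hG n
  rw [← hx, Subsingleton.elim ((Ext.mk₀ (ModuleCat.ofHom p)).comp x (zero_add _)) 0,
    Ext.comp_zero]

theorem ExtVanishing.prod [Module.Projective R P] (hG : ExtVanishing R G) :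
    ExtVanishing R (P × G) := fun n => by
  refine subsingleton_of_forall_eq 0 fun x => ?_
  have : Projective (ModuleCat.of R P) := (IsProjective.iff_projective P).1 inferInstance
  obtain ⟨y, rfl⟩ := Ext.contravariant_sequence_exact₂
    (exactComplex_shortExact (R := R) (K := P) (P := P × G) (G := G) LinearMap.inl_injective
      Function.Exact.inl_snd LinearMap.snd_surjective) _ x
    (Ext.eq_zero_of_projective (P := ModuleCat.of R P) _)
  have := hG n
  rw [Subsingleton.elim y 0, Ext.comp_zero]

/-- A finitely generated projective is a retract of some `R^n`, so the extension can be made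
coordinatewise. -/
theorem exists_extension_to_projective {i : K →ₗ[R] G}
    (hext : ∀ φ : K →ₗ[R] R, ∃ ψ : G →ₗ[R] R, ψ ∘ₗ i = φ)
    [Module.Finite R P] [Module.Projective R P] (φ : K →ₗ[R] P) :
    ∃ ψ : G →ₗ[R] P, ψ ∘ₗ i = φ := by
  obtain ⟨n, r, s, -, -, hrs⟩ := Module.Finite.exists_comp_eq_id_of_projective R P
  choose ψ hψ using fun j : Fin n => hext (LinearMap.proj j ∘ₗ s ∘ₗ φ)
  refine ⟨r ∘ₗ LinearMap.pi ψ, ?_⟩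
  have : LinearMap.pi ψ ∘ₗ i = s ∘ₗ φ := by
    ext x j; exact LinearMap.congr_fun (hψ j) x
  rw [LinearMap.comp_assoc, this, ← LinearMap.comp_assoc, hrs, LinearMap.id_comp]

/-- There is a short exact sequence `0 ⟶ G ⟶ P ⟶ G' ⟶ 0` with `P` finitely generated projective
that stays exact under `Hom(-, R)`. -/
def Step (G G' : ModuleCat.{u} R) : Prop :=
  ∃ (P : ModuleCat.{u} R) (ι : G →ₗ[R] P) (π : P →ₗ[R] G'),
    Module.Finite R P ∧ Module.Projective R P ∧ Function.Injective ι ∧ Function.Exact ι π ∧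
      Function.Surjective π ∧ ∀ φ : G →ₗ[R] R, ∃ ψ : P →ₗ[R] R, ψ ∘ₗ ι = φ

/-- Splicing the short exact sequences gives the complete resolution: the differential is `P i ↠ G
(i + 1) ↪ P (i + 1)`, so the kernel of `d 1` is the copy of `G 1` in `P 1`. -/
theorem gproj_of_steps (G : ℤ → ModuleCat.{u} R) (h : ∀ i, Step (G i) (G (i + 1))) :
    Gproj R (G 1) := by
  choose P ι π hfin hproj hinj hex hsurj hext using h
  exact ⟨{
    P := P
    d := fun i => ι (i + 1) ∘ₗ π i
    finite := hfin
    projective := hproj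
    exact := fun i x => by
      constructor
      · intro hx
        have : π (i + 1) x = 0 := hinj _ (hx.trans (map_zero _).symm)
        obtain ⟨y, rfl⟩ := (hex (i + 1) x).1 this
        obtain ⟨z, rfl⟩ := hsurj _ y
        exact ⟨z, rfl⟩
      · rintro ⟨y, rfl⟩
        simp only [LinearMap.comp_apply, (hex (i + 1)).apply_apply_eq_zero, map_zero]
    hom_exact := fun i f => by
      constructor
      · intro hf
        have hker : LinearMap.ker (π (i + 1)) ≤ LinearMap.ker f := by
          -- A map that vanishes on the image of the preceding differential vanishes on the kernel
          -- of `π`, so it factors through the next `G` and then extends by `hext`.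
          intro x hx
          obtain ⟨y, rfl⟩ := (hex (i + 1) x).1 hx
          obtain ⟨z, rfl⟩ := hsurj _ y
          exact LinearMap.congr_fun hf z
        let e := (π (i + 1)).quotKerEquivOfSurjective (hsurj _)
        let g := (LinearMap.ker (π (i + 1))).liftQ f hker ∘ₗ e.symm.toLinearMap
        have hg : g ∘ₗ π (i + 1) = f := by
          ext x
          have : e.symm (π (i + 1) x) = Submodule.Quotient.mk x := e.symm_apply_eq.2 rfl
          simp [g, this]
        obtain ⟨ψ, hψ⟩ := hext _ g
        exact ⟨ψ, by rw [← hg, ← hψ]; rfl⟩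
      · rintro ⟨g, rfl⟩
        ext x
        simp [(hex (i + 1)).apply_apply_eq_zero]
    iso := LinearEquiv.ofBijective
      ((ι 1).codRestrict _ fun x => by
        simp [(hex 1).apply_apply_eq_zero])
      ⟨fun x y hxy => hinj 1 (congrArg Subtype.val hxy), fun ⟨x, hx⟩ => by
        have : π 1 x = 0 := hinj _ (hx.trans (map_zero _).symm)
        obtain ⟨y, rfl⟩ := (hex 1 x).1 this
        exact ⟨y, rfl⟩⟩ }⟩

/-- `C` allows unlimited steps to the right and `D` to the left; choosing them successively from `G`
produces a two-sided sequence. -/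
theorem gproj_of_closed (C D : ModuleCat.{u} R → Prop)
    (hC : ∀ G, C G → ∃ G', C G' ∧ Step G G') (hD : ∀ G, D G → ∃ G', D G' ∧ Step G' G)
    {G : ModuleCat.{u} R} (hGC : C G) (hGD : D G) : Gproj R G := by
  choose next hnext using fun G : {G // C G} => hC G.1 G.2
  choose prev hprev using fun G : {G // D G} => hD G.1 G.2
  let a : ℕ → {G // C G} := fun n => (fun G => ⟨next G, (hnext G).1⟩)^[n] ⟨G, hGC⟩
  let b : ℕ → {G // D G} := fun n => (fun G => ⟨prev G, (hprev G).1⟩)^[n] ⟨G, hGD⟩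
  let s : ℤ → ModuleCat.{u} R := fun
    | Int.ofNat n => (a n).1
    | Int.negSucc n => (b (n + 1)).1
  have ha : ∀ n, Step (a n).1 (a (n + 1)).1 := fun n => by
    simp only [a, Function.iterate_succ_apply']
    exact (hnext _).2
  have hb : ∀ n, Step (b (n + 1)).1 (b n).1 := fun n => by
    simp only [b, Function.iterate_succ_apply']
    exact (hprev _).2
  have hs : ∀ i, Step (s i) (s (i + 1)) := fun
    | Int.ofNat n => ha n
    | Int.negSucc 0 => hb 0
    | Int.negSucc (n + 1) => hb (n + 1)
  -- `G` sits at index `0` of `s`, whereas the complete resolution is read off at index `1`.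
  exact gproj_of_steps (fun i => s (i - 1)) fun i => by
    have : i + 1 - 1 = i - 1 + 1 := by ring
    rw [this]
    exact hs _

theorem gproj_of_equiv (e : G ≃ₗ[R] H) (h : Gproj R (ModuleCat.of R H)) :
    Gproj R (ModuleCat.of R G) :=
  h.map fun c => { c with iso := e.trans c.iso }

theorem gproj_finite (h : Gproj R (ModuleCat.of R G)) : Module.Finite R G := by
  obtain ⟨c⟩ := h
  have := c.finite 0
  have hex : Function.Exact (c.d 0) (c.d 1) := c.exact 0
  refine Module.Finite.of_surjective (c.iso.symm.toLinearMap ∘ₗ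
    (c.d 0).codRestrict (LinearMap.ker (c.d 1)) fun x => hex.apply_apply_eq_zero x)
    (c.iso.symm.surjective.comp fun ⟨x, hx⟩ => ?_)
  obtain ⟨y, rfl⟩ := (hex x).1 hx
  exact ⟨y, rfl⟩

/-- The map from `P i` onto the kernel of the next differential. -/
def CompleteProjectiveResolution.toKer (c : CompleteProjectiveResolution R G) (i : ℤ) :
    c.P i →ₗ[R] LinearMap.ker (c.d (i + 1)) :=
  (c.d i).codRestrict _ fun x => (c.exact i).apply_apply_eq_zero x

theorem CompleteProjectiveResolution.toKer_surjective (c : CompleteProjectiveResolution R G)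
    (i : ℤ) : Function.Surjective (c.toKer i) := fun ⟨x, hx⟩ => by
  obtain ⟨y, rfl⟩ := (c.exact i x).1 hx
  exact ⟨y, rfl⟩

theorem CompleteProjectiveResolution.exact_subtype_toKer (c : CompleteProjectiveResolution R G)
    (i : ℤ) : Function.Exact (LinearMap.ker (c.d i)).subtype (c.toKer i) := fun x => by
  constructor
  · intro hx
    exact ⟨⟨x, congrArg Subtype.val hx⟩, rfl⟩
  · rintro ⟨y, rfl⟩
    exact Subtype.ext y.2

theorem CompleteProjectiveResolution.extVanishing_ker (c : CompleteProjectiveResolution R G)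
    (n : ℕ) : ∀ i : ℤ, Subsingleton (Ext.{u} (ModuleCat.of R (LinearMap.ker (c.d i)))
      (ModuleCat.of R R) (n + 1)) := by
  induction n with
  | zero =>
    intro i
    -- Three terms are needed below index `i`: `P (l + 2)` covers the kernel in question, `P (l +
    -- 1)` covers its syzygy, and the image of `P l` is the kernel of that second cover. Thus
    -- `hom_exact` at `l` yields the extension.
    obtain ⟨l, rfl⟩ : ∃ l, i = l + 1 + 1 + 1 := ⟨i - 3, by ring⟩
    have := c.projective (l + 1 + 1)
    refine ext_one_of_exists_extension (Subtype.val_injective)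
      (c.exact_subtype_toKer (l + 1 + 1)) (c.toKer_surjective _) fun φ => ?_
    have h0 : (φ ∘ₗ c.toKer (l + 1)) ∘ₗ c.d l = 0 := by
      ext x
      have : c.toKer (l + 1) (c.d l x) = 0 := Subtype.ext ((c.exact l).apply_apply_eq_zero x)
      simp [this]
    obtain ⟨ψ, hψ⟩ := (c.hom_exact l _).1 h0
    refine ⟨ψ, ?_⟩
    ext x
    obtain ⟨y, rfl⟩ := c.toKer_surjective (l + 1) x
    exact LinearMap.congr_fun hψ y
  | succ n ih =>
    intro i
    obtain ⟨l, rfl⟩ : ∃ l, i = l + 1 := ⟨i - 1, by ring⟩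
    have := c.projective l
    exact ext_succ_of_syzygy (Subtype.val_injective)
      (c.exact_subtype_toKer l) (c.toKer_surjective _) (ih l)

theorem gproj_extVanishing (h : Gproj R (ModuleCat.of R G)) : ExtVanishing R G := by
  obtain ⟨c⟩ := h
  exact ExtVanishing.retract (G := LinearMap.ker (c.d 1)) (fun n => c.extVanishing_ker n 1)
    c.iso.toLinearMap c.iso.symm.toLinearMap (by ext x; simp)

theorem exists_cosyzygy (h : Gproj R (ModuleCat.of R G)) :
    ∃ (P G' : ModuleCat.{u} R) (ι : G →ₗ[R] P) (π : P →ₗ[R] G'),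
      Module.Finite R P ∧ Module.Projective R P ∧ Function.Injective ι ∧ Function.Exact ι π ∧
        Function.Surjective π ∧ Gproj R G' := by
  obtain ⟨c⟩ := h
  refine ⟨c.P 1, ModuleCat.of R (LinearMap.ker (c.d (1 + 1))),
    (LinearMap.ker (c.d 1)).subtype ∘ₗ c.iso.toLinearMap, c.toKer 1, c.finite 1, c.projective 1,
    Subtype.val_injective.comp c.iso.injective, fun x => ?_, c.toKer_surjective 1,
    -- The cokernel `ker d 2` is resolved by the same complex shifted by one.
    ⟨{ P := fun i => c.P (i + 1)
       d := fun i => c.d (i + 1)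
       finite := fun i => c.finite _
       projective := fun i => c.projective _
       exact := fun i => c.exact _
       hom_exact := fun i => c.hom_exact _
       iso := LinearEquiv.refl _ _ }⟩⟩
  rw [c.exact_subtype_toKer 1 x]
  constructor
  · rintro ⟨y, rfl⟩
    obtain ⟨z, rfl⟩ := c.iso.surjective y
    exact ⟨z, rfl⟩
  · rintro ⟨z, rfl⟩
    exact ⟨c.iso z, rfl⟩

/-- Gorenstein projectives are torsionless: they embed in a projective, hence in some `R^n`, whose
coordinates separate points. -/
theorem eq_zero_of_gproj (h : Gproj R (ModuleCat.of R G)) {x : G}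
    (hx : ∀ φ : G →ₗ[R] R, φ x = 0) : x = 0 := by
  obtain ⟨P, -, ι, -, _, _, hι, -⟩ := exists_cosyzygy h
  obtain ⟨n, r, s, -, -, hrs⟩ := Module.Finite.exists_comp_eq_id_of_projective R P
  refine hι ?_
  rw [map_zero, ← LinearMap.id_apply (R := R) (ι x), ← hrs, LinearMap.comp_apply]
  have : s (ι x) = 0 := funext fun j => hx (LinearMap.proj j ∘ₗ s ∘ₗ ι)
  rw [this, map_zero]

variable [IsNoetherianRing R]

/-- Only the right half needs data. To the left, finitely generated modules with vanishing Ext into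
`R` are closed under syzygies over a Noetherian ring. To the right, `Ext^1(G', R) = 0` keeps the
sequence exact under `Hom(-, R)`. -/
theorem gproj_of_coresolution (C : ModuleCat.{u} R → Prop)
    (hC : ∀ G, C G → Module.Finite R G ∧ ExtVanishing R G ∧
      ∃ (P G' : ModuleCat.{u} R) (ι : G →ₗ[R] P) (π : P →ₗ[R] G'),
        Module.Finite R P ∧ Module.Projective R P ∧ Function.Injective ι ∧ Function.Exact ι π ∧
          Function.Surjective π ∧ C G') {G : ModuleCat.{u} R} (hG : C G) : Gproj R G := by
  refine gproj_of_closed C (fun G => Module.Finite R G ∧ ExtVanishing R G) ?_ ?_ hG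
    ⟨(hC G hG).1, (hC G hG).2.1⟩
  · intro G hG
    obtain ⟨-, -, P, G', ι, π, hP, hP', hι, hex, hπ, hG'⟩ := hC G hG
    exact ⟨G', hG', P, ι, π, hP, hP', hι, hex, hπ,
      exists_extension_of_ext_one ((hC G' hG').2.1 0) hι hex hπ⟩
  · rintro G ⟨hG, hG'⟩
    obtain ⟨n, f, hf⟩ := Module.Finite.exists_fin' R G
    have hex := LinearMap.exact_subtype_ker_map f
    exact ⟨ModuleCat.of R (LinearMap.ker f), ⟨inferInstance,
      hG'.syzygy Subtype.val_injective hex hf⟩, ModuleCat.of R (Fin n → R),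
      (LinearMap.ker f).subtype, f, inferInstance, inferInstance, Subtype.val_injective, hex, hf,
      exists_extension_of_ext_one (hG' 0) Subtype.val_injective hex hf⟩

theorem gproj_of_cosyzygy [Module.Finite R P] [Module.Projective R P] [Module.Finite R K]
    (hK : ExtVanishing R K) {ι : K →ₗ[R] P} {π : P →ₗ[R] G} (hι : Function.Injective ι)
    (hex : Function.Exact ι π) (hπ : Function.Surjective π) (hG : Gproj R (ModuleCat.of R G)) :
    Gproj R (ModuleCat.of R K) := by
  refine gproj_of_coresolution (fun K => Module.Finite R K ∧ ExtVanishing R K ∧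
      ∃ (P G' : ModuleCat.{u} R) (ι : K →ₗ[R] P) (π : P →ₗ[R] G'),
        Module.Finite R P ∧ Module.Projective R P ∧ Function.Injective ι ∧ Function.Exact ι π ∧
          Function.Surjective π ∧ Gproj R G') ?_
    ⟨‹_›, hK, ModuleCat.of R P, ModuleCat.of R G, ι, π, ‹_›, ‹_›, hι, hex, hπ, hG⟩
  -- The class is closed because every Gorenstein projective module, in particular `G'`, belongs to
  -- it.
  rintro K ⟨hK, hK', P, G', ι, π, hP, hP', hι, hex, hπ, hG'⟩
  exact ⟨hK, hK', P, G', ι, π, hP, hP', hι, hex, hπ,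
    gproj_finite hG', gproj_extVanishing hG', exists_cosyzygy hG'⟩

theorem gproj_syzygy [Module.Finite R P] [Module.Projective R P] {ι : K →ₗ[R] P}
    {π : P →ₗ[R] G} (hι : Function.Injective ι) (hex : Function.Exact ι π)
    (hπ : Function.Surjective π) (hG : Gproj R (ModuleCat.of R G)) :
    Gproj R (ModuleCat.of R K) :=
  have : Module.Finite R K := Module.Finite.of_injective ι hι
  gproj_of_cosyzygy ((gproj_extVanishing hG).syzygy hι hex hπ) hι hex hπ hG

theorem gproj_prod [Module.Finite R P] [Module.Projective R P]
    (hG : Gproj R (ModuleCat.of R G)) : Gproj R (ModuleCat.of R (P × G)) := by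
  obtain ⟨Q, G', ι, π, _, _, hι, hex, hπ, hG'⟩ := exists_cosyzygy hG
  have := gproj_finite hG
  refine gproj_of_cosyzygy (P := P × Q) (G := G') (gproj_extVanishing hG).prod
    (ι := LinearMap.id.prodMap ι) (π := π ∘ₗ LinearMap.snd R P Q)
    (Function.injective_id.prodMap hι) ?_ (hπ.comp LinearMap.snd_surjective) hG'
  rintro ⟨p, q⟩
  refine (hex q).trans ⟨?_, ?_⟩
  · rintro ⟨y, rfl⟩
    exact ⟨(p, y), rfl⟩
  · rintro ⟨⟨p', y⟩, h⟩
    exact ⟨y, congrArg Prod.snd h⟩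

/-- Embed `G × P` in a projective `Q` with Gorenstein projective cokernel `M`. The projection to `P`
extends to `Q`, so `Q / G ≅ P × M`, which again becomes Gorenstein projective after adding `P`; the
class of such `G` therefore has coresolutions. -/
theorem gproj_of_gproj_prod [Module.Finite R P] [Module.Projective R P]
    (h : Gproj R (ModuleCat.of R (G × P))) : Gproj R (ModuleCat.of R G) := by
  refine gproj_of_coresolution (fun G => ∃ P : ModuleCat.{u} R, Module.Finite R P ∧
    Module.Projective R P ∧ Gproj R (ModuleCat.of R (G × P))) ?_
    (G := ModuleCat.of R G) ⟨ModuleCat.of R P, ‹_›, ‹_›, h⟩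
  rintro G ⟨P, _, _, h⟩
  have := gproj_finite h
  obtain ⟨Q, M, ι, π, _, _, hι, hex, hπ, hM⟩ := exists_cosyzygy h
  obtain ⟨ρ, hρ⟩ := exists_extension_to_projective
    (exists_extension_of_ext_one (gproj_extVanishing hM 0) hι hex hπ) (LinearMap.snd R G P)
  refine ⟨Module.Finite.of_surjective (LinearMap.fst R G P) LinearMap.fst_surjective,
    (gproj_extVanishing h).retract (LinearMap.inl R G P) (LinearMap.fst R G P)
      (LinearMap.fst_comp_inl R G P), Q, ModuleCat.of R (P × M), ι ∘ₗ LinearMap.inl R G P,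
      ρ.prod π, ‹_›, ‹_›, hι.comp LinearMap.inl_injective, fun q => ⟨fun hq => ?_, ?_⟩, ?_,
      P, ‹_›, ‹_›, gproj_of_equiv (LinearEquiv.prodComm R _ _) (gproj_prod (gproj_prod hM))⟩
  · obtain ⟨⟨g, p⟩, rfl⟩ := (hex q).1 (congrArg Prod.snd hq)
    have hp : p = 0 := (LinearMap.congr_fun hρ (g, p)).symm.trans (congrArg Prod.fst hq)
    exact ⟨g, by rw [hp]; rfl⟩
  · rintro ⟨g, rfl⟩
    exact Prod.ext (LinearMap.congr_fun hρ (g, 0)) (hex.apply_apply_eq_zero _)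
  · rintro ⟨p, m⟩
    obtain ⟨q, rfl⟩ := hπ m
    have h1 : ∀ p : P, ρ (ι (0, p)) = p := fun p => LinearMap.congr_fun hρ (0, p)
    refine ⟨q + ι (0, p - ρ q), Prod.ext ?_ ?_⟩
    · simp [h1]
    · simp [hex.apply_apply_eq_zero]

/-- Dual Schanuel: comparison with a cosyzygy `M` of `G` from a complete resolution gives `H × Q ≅ P
× M`, and the projective factor `Q` can be cancelled. -/
theorem gproj_cosyzygy [Module.Finite R P] [Module.Projective R P] {ι : G →ₗ[R] P}
    {π : P →ₗ[R] H} (hex : Function.Exact ι π) (hπ : Function.Surjective π)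
    (hG : Gproj R (ModuleCat.of R G))
    (hext : ∀ φ : G →ₗ[R] R, ∃ ψ : P →ₗ[R] R, ψ ∘ₗ ι = φ) :
    Gproj R (ModuleCat.of R H) := by
  obtain ⟨Q, M, j, ρ, _, _, hj, hjρ, hρ, hM⟩ := exists_cosyzygy hG
  obtain ⟨a, ha⟩ := exists_extension_to_projective hext j
  obtain ⟨b, hb⟩ := exists_extension_to_projective
    (exists_extension_of_ext_one (gproj_extVanishing hM 0) hj hjρ hρ) ι
  replace ha : ∀ x, a (ι x) = j x := LinearMap.congr_fun ha
  replace hb : ∀ x, b (j x) = ι x := LinearMap.congr_fun hb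
  let u : P × Q →ₗ[R] H × Q := (π ∘ₗ LinearMap.fst R P Q).prod (LinearMap.snd R P Q +
    a ∘ₗ LinearMap.fst R P Q)
  let v : P × Q →ₗ[R] P × M := (LinearMap.fst R P Q + b ∘ₗ LinearMap.snd R P Q).prod
    (ρ ∘ₗ LinearMap.snd R P Q)
  have hu : Function.Surjective u := by
    rintro ⟨h, q⟩
    obtain ⟨p, rfl⟩ := hπ h
    exact ⟨(p, q - a p), by simp [u]⟩
  have hv : Function.Surjective v := by
    rintro ⟨p, m⟩
    obtain ⟨q, rfl⟩ := hρ m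
    exact ⟨(p - b q, q), by simp [v]⟩
  -- Both kernels are the antidiagonal image of `G`, the pairs `(ι g, -j g)`.
  have huv : LinearMap.ker u = LinearMap.ker v := by
    ext ⟨p, q⟩
    have h1 : (p, q) ∈ LinearMap.ker u ↔ π p = 0 ∧ q + a p = 0 := Prod.mk_eq_zero
    have h2 : (p, q) ∈ LinearMap.ker v ↔ p + b q = 0 ∧ ρ q = 0 := Prod.mk_eq_zero
    rw [h1, h2]
    constructor
    · rintro ⟨h1, h2⟩
      obtain ⟨g, rfl⟩ := (hex p).1 h1
      rw [ha] at h2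
      obtain rfl : q = - j g := eq_neg_of_add_eq_zero_left h2
      simp [hb, hjρ.apply_apply_eq_zero]
    · rintro ⟨h1, h2⟩
      obtain ⟨g, rfl⟩ := (hjρ q).1 h2
      rw [hb] at h1
      obtain rfl : p = - ι g := eq_neg_of_add_eq_zero_left h1
      simp [ha, hex.apply_apply_eq_zero]
  have e : (H × Q) ≃ₗ[R] (P × M) := (u.quotKerEquivOfSurjective hu).symm ≪≫ₗ
    Submodule.quotEquivOfEq _ _ huv ≪≫ₗ v.quotKerEquivOfSurjective hv
  exact gproj_of_gproj_prod (gproj_of_equiv e (gproj_prod hM))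

end GorensteinProjective

/-! ### From vanishing of `Tor_1` to injectivity on syzygies. -/

section TorOne

open CategoryTheory

variable {R : Type u} [Ring R]

/-- An element of `M ⊗ ker p` lifts to `M ⊗ P₁`. If it dies in `M ⊗ P₀`, the lift comes from `M ⊗
P₂`, and `P₂ → P₁ → ker p` is zero. -/
theorem TensorOver.map_ker_subtype_injective {S M : Type u} [Ring S] [AddCommGroup M] [Module S M]
    [Module Rᵐᵒᵖ M] [SMulCommClass S Rᵐᵒᵖ M] {P₂ P₁ P₀ X : Type u} [AddCommGroup P₂] [Module R P₂]
    [AddCommGroup P₁] [Module R P₁] [AddCommGroup P₀] [Module R P₀] [AddCommGroup X] [Module R X]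
    {d : P₂ →ₗ[R] P₁} {e : P₁ →ₗ[R] P₀} {p : P₀ →ₗ[R] X} (hed : e ∘ₗ d = 0)
    (hep : Function.Exact e p)
    (hM : ∀ y, TensorOver.map S R M e y = 0 → ∃ w, TensorOver.map S R M d w = y) :
    Function.Injective (TensorOver.map S R M (LinearMap.ker p).subtype) := by
  let q : P₁ →ₗ[R] LinearMap.ker p := e.codRestrict _ fun x => hep.apply_apply_eq_zero x
  have hq : Function.Surjective q := fun ⟨x, hx⟩ => by
    obtain ⟨y, hy⟩ := (hep x).1 hx
    exact ⟨y, Subtype.ext hy⟩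
  rw [injective_iff_map_eq_zero]
  intro z hz
  obtain ⟨y, rfl⟩ := TensorOver.map_surjective (S := S) (M := M) hq z
  rw [TensorOver.map_comp_apply] at hz
  obtain ⟨w, rfl⟩ := hM y hz
  have : q ∘ₗ d = 0 := by
    ext x
    exact LinearMap.congr_fun hed x
  rw [TensorOver.map_comp_apply, this, TensorOver.map_zero_apply]

/-- The cover `p` is chosen before the bimodule `M`, so a single syzygy serves for all the `A ⊗
D(S)` simultaneously. -/
theorem exists_projective_tor_one (X : ModuleCat.{u} R) :
    ∃ (P : ModuleCat.{u} R) (p : P →ₗ[R] X), Module.Projective R P ∧ Function.Surjective p ∧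
      ∀ (S M : Type u) [Ring S] [AddCommGroup M] [Module S M] [Module Rᵐᵒᵖ M]
        [SMulCommClass S Rᵐᵒᵖ M], Limits.IsZero ((Tor S R M 1).obj X) →
        Function.Injective (TensorOver.map S R M (LinearMap.ker p).subtype) := by
  let Q := projectiveResolution X
  have hp : Module.Projective R (Q.complex.X 0) :=
    (IsProjective.iff_projective _).2 (Q.projective 0)
  refine ⟨Q.complex.X 0, (Q.π.f 0).hom, hp, (ModuleCat.epi_iff_surjective _).1 inferInstance,
    fun S M _ _ _ _ _ h => ?_⟩
  have h1 : ((tensorFunctor S R M).mapHomologicalComplex _ |>.obj Q.complex).ExactAt 1 := by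
    rw [HomologicalComplex.exactAt_iff_isZero_homology]
    exact h.of_iso (Q.isoLeftDerivedObj (tensorFunctor S R M) 1).symm
  rw [HomologicalComplex.exactAt_iff' _ 2 1 0 (by simp) (by simp),
    ShortComplex.moduleCat_exact_iff] at h1
  have h0 := (ShortComplex.moduleCat_exact_iff _).1 Q.exact₀
  refine TensorOver.map_ker_subtype_injective (P₁ := Q.complex.X 1) (P₂ := Q.complex.X 2)
    (d := (Q.complex.d 2 1).hom) (e := (Q.complex.d 1 0).hom) ?_ (fun x => ⟨h0 x, ?_⟩) h1
  · exact congrArg ModuleCat.Hom.hom (Q.complex.d_comp_d 2 1 0)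
  · rintro ⟨y, rfl⟩
    exact LinearMap.congr_fun (congrArg ModuleCat.Hom.hom Q.complex_d_comp_π_f_zero) y

end TorOne

/-! ### Vector space duality between right and left `B`-modules. -/

section Dual

variable (k : Type u) [Field k] (B : Type u) [Ring B] [Algebra k B]
variable (V : Type u) [AddCommGroup V] [Module k V] [Module Bᵐᵒᵖ V] [IsScalarTower k Bᵐᵒᵖ V]

/-- The dual of a right `B`-module, to be regarded as a left `B`-module. -/
def LeftDual : Type u := Module.Dual k V

namespace LeftDual

instance : AddCommGroup (LeftDual k V) := inferInstanceAs (AddCommGroup (Module.Dual k V))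

instance : Module k (LeftDual k V) := inferInstanceAs (Module k (Module.Dual k V))

/-- The identification with the dual vector space. -/
def equiv : LeftDual k V ≃ₗ[k] Module.Dual k V := LinearEquiv.refl k (Module.Dual k V)

/-- The left `B`-action: `(b f)(v) = f (v b)`. -/
instance : Module B (LeftDual k V) where
  smul b f := (equiv k V).symm ((equiv k V f).comp (Algebra.lsmul k k V (MulOpposite.op b)))
  one_smul f := LinearMap.ext fun s => congrArg (equiv k V f) (one_smul Bᵐᵒᵖ s)
  mul_smul b c f := LinearMap.ext fun s =>
    congrArg (equiv k V f) (mul_smul (MulOpposite.op c) (MulOpposite.op b) s)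
  smul_zero _ := rfl
  smul_add _ _ _ := rfl
  add_smul b c f := LinearMap.ext fun s =>
    (congrArg (equiv k V f) (add_smul (MulOpposite.op b) (MulOpposite.op c) s)).trans
      (map_add (equiv k V f) _ _)
  zero_smul f := LinearMap.ext fun s =>
    (congrArg (equiv k V f) (zero_smul Bᵐᵒᵖ s)).trans (map_zero (equiv k V f))

variable {k B V}

instance : IsScalarTower k B (LeftDual k V) where
  smul_assoc c b f := LinearMap.ext fun s =>
    (congrArg (equiv k V f) (smul_assoc c (MulOpposite.op b) s)).trans
      (map_smul (equiv k V f) c _)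

variable [FiniteDimensional k V]

variable (k B V) in
/-- `V ≅ D(D(V))`. -/
def evalEquiv : V ≃ₗ[Bᵐᵒᵖ] RightDual k (LeftDual k V) :=
  { (Module.evalEquiv k V).toAddEquiv with
    map_smul' := fun _ _ => rfl }

/-- A submodule `N` of the dual is recovered from its annihilator `W` in `V`, by the double
annihilator theorem in finite dimension, and `W` is a submodule of the simple module `V`. -/
theorem isSimpleModule [IsSimpleModule Bᵐᵒᵖ V] : IsSimpleModule B (LeftDual k V) := by
  have hV : Nontrivial V := IsSimpleModule.nontrivial Bᵐᵒᵖ V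
  have : Nontrivial (LeftDual k V) := inferInstanceAs (Nontrivial (Module.Dual k V))
  refine { exists_pair_ne := ⟨⊥, ⊤, bot_ne_top⟩, eq_bot_or_eq_top := fun N => ?_ }
  let W : Submodule Bᵐᵒᵖ V :=
    { carrier := {v | ∀ f ∈ N, equiv k V f v = 0}
      add_mem' := fun hv hw f hf => by rw [map_add, hv f hf, hw f hf, add_zero]
      zero_mem' := fun f _ => map_zero _
      smul_mem' := fun b v hv f hf => hv (b.unop • f) (N.smul_mem _ hf) }
  let N' : Submodule k (Module.Dual k V) := (N.restrictScalars k).map (equiv k V).toLinearMap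
  have hN : ∀ f, f ∈ N ↔ equiv k V f ∈ N' := fun f =>
    ⟨fun h => ⟨f, h, rfl⟩, fun ⟨g, hg, h⟩ => (equiv k V).injective h ▸ hg⟩
  have hW : ∀ v, v ∈ W ↔ v ∈ N'.dualCoannihilator := fun v => by
    rw [Submodule.mem_dualCoannihilator]
    exact ⟨fun h f ⟨g, hg, e⟩ => e ▸ h g hg, fun h f hf => h _ ((hN f).1 hf)⟩
  have hN' := Subspace.dualCoannihilator_dualAnnihilator_eq (W := N')
  rcases eq_bot_or_eq_top W with h | h
  · right
    rw [eq_top_iff]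
    intro f _
    rw [hN, ← hN', Submodule.mem_dualAnnihilator]
    intro v hv
    have : v ∈ W := (hW v).2 hv
    rw [h, Submodule.mem_bot] at this
    rw [this, map_zero]
  · left
    rw [eq_bot_iff]
    intro f hf
    rw [Submodule.mem_bot]
    refine (equiv k V).injective (LinearMap.ext fun v => ?_)
    have : v ∈ W := h ▸ Submodule.mem_top
    exact this f hf

end LeftDual

end Dual

/-! ### The bifunctor `V ⊗_B X`. -/

section Ind

variable {k A B : Type u} [Field k] [Ring A] [Algebra k A] [Ring B] [Algebra k B]

section

variable {V W U : Type u} [AddCommGroup V] [Module k V] [Module Bᵐᵒᵖ V] [IsScalarTower k Bᵐᵒᵖ V]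
  [AddCommGroup W] [Module k W] [Module Bᵐᵒᵖ W] [IsScalarTower k Bᵐᵒᵖ W]
  [AddCommGroup U] [Module k U] [Module Bᵐᵒᵖ U] [IsScalarTower k Bᵐᵒᵖ U]

namespace Ind

instance : Module.Free A (Ind k A V) := inferInstanceAs (Module.Free A (A ⊗[k] V))

instance [FiniteDimensional k V] : Module.Finite A (Ind k A V) :=
  inferInstanceAs (Module.Finite A (A ⊗[k] V))

/-- The pure tensor `a ⊗ v`. -/
def tmul (k : Type u) {A V : Type u} [Field k] [Ring A] [Algebra k A] [AddCommGroup V]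
    [Module k V] (a : A) (v : V) : Ind k A V := (equiv k A V).symm (a ⊗ₜ v)

theorem induction_on {p : Ind k A V → Prop} (z : Ind k A V) (zero : p 0)
    (tmul : ∀ a v, p (tmul k a v)) (add : ∀ x y, p x → p y → p (x + y)) : p z := by
  obtain ⟨t, rfl⟩ := (equiv k A V).symm.surjective z
  induction t with
  | zero => exact zero
  | tmul a v => exact tmul a v
  | add x y hx hy => rw [map_add]; exact add _ _ hx hy

theorem op_smul_tmul' (a a' : A) (b : B) (v : V) :
    MulOpposite.op (a ⊗ₜ[k] b) • tmul k a' v = tmul k (a' * a) (MulOpposite.op b • v) :=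
  op_smul_tmul k A B V a a' b v

theorem smul_tmul (a a' : A) (v : V) : a • tmul k a' v = tmul k (a * a') v := rfl

theorem tmul_add (a : A) (v w : V) : tmul k a (v + w) = tmul k a v + tmul k a w :=
  TensorProduct.tmul_add a v w

theorem tmul_smul (c : k) (a : A) (v : V) : tmul k a (c • v) = tmul k (c • a) v :=
  (TensorProduct.smul_tmul c a v).symm

/-- The map `A ⊗_k f`. -/
def map (A : Type u) [Ring A] [Algebra k A] (f : V →ₗ[Bᵐᵒᵖ] W) : Ind k A V →ₗ[A] Ind k A W :=
  (f.restrictScalars k).baseChange A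

theorem map_tmul (f : V →ₗ[Bᵐᵒᵖ] W) (a : A) (v : V) :
    map A f (tmul k a v) = tmul k a (f v) := rfl

theorem map_op_smul (f : V →ₗ[Bᵐᵒᵖ] W) (r : (A ⊗[k] B)ᵐᵒᵖ) (m : Ind k A V) :
    map A f (r • m) = r • map A f m := by
  obtain ⟨t, rfl⟩ := MulOpposite.op_surjective r
  induction t with
  | zero => simp
  | add x y hx hy => rw [MulOpposite.op_add, add_smul, add_smul, map_add, hx, hy]
  | tmul a b =>
    induction m using induction_on with
    | zero => simp
    | tmul a' v => simp only [map_tmul, op_smul_tmul', map_smul]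
    | add x y hx hy => rw [smul_add, map_add, map_add, smul_add, hx, hy]

theorem map_injective {f : V →ₗ[Bᵐᵒᵖ] W} (hf : Function.Injective f) :
    Function.Injective (map (k := k) A f) :=
  Module.Flat.lTensor_preserves_injective_linearMap (M := A) (f.restrictScalars k) hf

theorem map_surjective {f : V →ₗ[Bᵐᵒᵖ] W} (hf : Function.Surjective f) :
    Function.Surjective (map (k := k) A f) :=
  LinearMap.lTensor_surjective A (g := f.restrictScalars k) hf

theorem map_exact {f : V →ₗ[Bᵐᵒᵖ] W} {g : W →ₗ[Bᵐᵒᵖ] U} (hfg : Function.Exact f g)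
    (hg : Function.Surjective g) : Function.Exact (map (k := k) A f) (map A g) :=
  lTensor_exact A (f := f.restrictScalars k) (g := g.restrictScalars k) hfg hg

end Ind

end

variable (k A B) in
/-- The `A`-module `V ⊗_B X ≅ (A ⊗_k V) ⊗_{A ⊗ B} X`. -/
abbrev RTensor (V X : Type u) [AddCommGroup V] [Module k V] [Module Bᵐᵒᵖ V]
    [IsScalarTower k Bᵐᵒᵖ V] [AddCommGroup X] [Module (A ⊗[k] B) X] : Type u :=
  TensorOver A (A ⊗[k] B) (Ind k A V) X

namespace RTensor

variable {V W U : Type u} [AddCommGroup V] [Module k V] [Module Bᵐᵒᵖ V] [IsScalarTower k Bᵐᵒᵖ V]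
  [AddCommGroup W] [Module k W] [Module Bᵐᵒᵖ W] [IsScalarTower k Bᵐᵒᵖ W]
  [AddCommGroup U] [Module k U] [Module Bᵐᵒᵖ U] [IsScalarTower k Bᵐᵒᵖ U]
variable {X Y Z : Type u} [AddCommGroup X] [Module (A ⊗[k] B) X] [AddCommGroup Y]
  [Module (A ⊗[k] B) Y] [AddCommGroup Z] [Module (A ⊗[k] B) Z]

variable (V) in
/-- The map `V ⊗ f`. -/
abbrev map (f : X →ₗ[A ⊗[k] B] Y) : RTensor k A B V X →ₗ[A] RTensor k A B V Y :=
  TensorOver.map A (A ⊗[k] B) (Ind k A V) f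

variable (A X) in
/-- The map `f ⊗ X`. -/
def mapLeft (f : V →ₗ[Bᵐᵒᵖ] W) : RTensor k A B V X →ₗ[A] RTensor k A B W X :=
  TensorOver.mapLeft X (Ind.map A f) (Ind.map_op_smul f)

theorem induction_on {p : RTensor k A B V X → Prop} (z : RTensor k A B V X) (zero : p 0)
    (tmk : ∀ (v : V) (x : X), p (TensorOver.tmk A (A ⊗[k] B) (Ind.tmul k 1 v) x))
    (add : ∀ a b, p a → p b → p (a + b)) : p z := by
  induction z using TensorOver.induction_on with
  | zero => exact zero
  | add a b ha hb => exact add a b ha hb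
  | tmk m x =>
    induction m using Ind.induction_on with
    | zero =>
      rw [show TensorOver.tmk A (A ⊗[k] B) (0 : Ind k A V) x = 0 from
        (TensorOver.tmkHom A (A ⊗[k] B) x).map_zero]
      exact zero
    | add m n hm hn => rw [TensorOver.add_tmk]; exact add _ _ hm hn
    | tmul a v =>
      have : Ind.tmul k a v = MulOpposite.op (a ⊗ₜ[k] (1 : B)) • Ind.tmul k 1 v := by
        rw [Ind.op_smul_tmul', one_mul, MulOpposite.op_one, one_smul]
      rw [this, TensorOver.op_smul_tmk]
      exact tmk _ _

theorem mapLeft_tmk (f : V →ₗ[Bᵐᵒᵖ] W) (a : A) (v : V) (x : X) :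
    mapLeft A X f (TensorOver.tmk A (A ⊗[k] B) (Ind.tmul k a v) x) =
      TensorOver.tmk A (A ⊗[k] B) (Ind.tmul k a (f v)) x := rfl

theorem mapLeft_map (f : V →ₗ[Bᵐᵒᵖ] W) (g : X →ₗ[A ⊗[k] B] Y) (z : RTensor k A B V X) :
    mapLeft A Y f (map V g z) = map W g (mapLeft A X f z) :=
  TensorOver.mapLeft_map _ _ _ _

theorem mapLeft_mapLeft (g : W →ₗ[Bᵐᵒᵖ] U) (f : V →ₗ[Bᵐᵒᵖ] W) (z : RTensor k A B V X) :
    mapLeft A X g (mapLeft A X f z) = mapLeft A X (g ∘ₗ f) z := by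
  induction z using induction_on with
  | zero => simp
  | tmk v x => rfl
  | add a b ha hb => simp only [map_add, ha, hb]

theorem mapLeft_id (z : RTensor k A B V X) :
    mapLeft A X (LinearMap.id : V →ₗ[Bᵐᵒᵖ] V) z = z := by
  induction z using induction_on with
  | zero => simp
  | tmk v x => rfl
  | add a b ha hb => simp only [map_add, ha, hb]

theorem mapLeft_zero (z : RTensor k A B V X) :
    mapLeft A X (0 : V →ₗ[Bᵐᵒᵖ] W) z = 0 := by
  induction z using induction_on with
  | zero => simp
  | tmk v x =>
    rw [mapLeft_tmk, LinearMap.zero_apply]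
    have : Ind.tmul k (1 : A) (0 : W) = 0 := TensorProduct.tmul_zero _ _
    rw [this]
    exact (TensorOver.tmkHom A (A ⊗[k] B) x).map_zero
  | add a b ha hb => simp only [map_add, ha, hb, add_zero]

theorem mapLeft_add (f g : V →ₗ[Bᵐᵒᵖ] W) (z : RTensor k A B V X) :
    mapLeft A X (f + g) z = mapLeft A X f z + mapLeft A X g z := by
  induction z using induction_on with
  | zero => simp
  | tmk v x =>
    simp only [mapLeft_tmk, LinearMap.add_apply, Ind.tmul_add, TensorOver.add_tmk]
  | add a b ha hb => simp only [map_add, ha, hb]; abel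

theorem mapLeft_sum {ι : Type*} (s : Finset ι) (f : ι → V →ₗ[Bᵐᵒᵖ] W) (z : RTensor k A B V X) :
    mapLeft A X (∑ i ∈ s, f i) z = ∑ i ∈ s, mapLeft A X (f i) z := by
  classical
  induction s using Finset.induction_on with
  | empty => simp [mapLeft_zero]
  | insert a s ha ih => rw [Finset.sum_insert ha, Finset.sum_insert ha, mapLeft_add, ih]

theorem mapLeft_surjective {f : V →ₗ[Bᵐᵒᵖ] W} (hf : Function.Surjective f) :
    Function.Surjective (mapLeft (k := k) A X f) :=
  TensorOver.mapLeft_surjective _ (Ind.map_surjective hf)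

theorem mapLeft_exact {f : V →ₗ[Bᵐᵒᵖ] W} {g : W →ₗ[Bᵐᵒᵖ] U} (hfg : Function.Exact f g)
    (hg : Function.Surjective g) : Function.Exact (mapLeft (k := k) A X f) (mapLeft A X g) :=
  TensorOver.mapLeft_exact _ _ (Ind.map_exact hfg hg) (Ind.map_surjective hg)

theorem mapLeft_injective_of_projective [Module.Projective (A ⊗[k] B) X] {f : V →ₗ[Bᵐᵒᵖ] W}
    (hf : Function.Injective f) : Function.Injective (mapLeft (k := k) A X f) :=
  TensorOver.mapLeft_injective_of_projective _ (Ind.map_injective hf)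

end RTensor

end Ind

/-! ### Flatness over `B`, tested on finite-dimensional modules. -/

section Flat

variable {k A B : Type u} [Field k] [Ring A] [Algebra k A] [Ring B] [Algebra k B]
variable {V W U : Type u} [AddCommGroup V] [Module k V] [Module Bᵐᵒᵖ V] [IsScalarTower k Bᵐᵒᵖ V]
  [AddCommGroup W] [Module k W] [Module Bᵐᵒᵖ W] [IsScalarTower k Bᵐᵒᵖ W]
  [AddCommGroup U] [Module k U] [Module Bᵐᵒᵖ U] [IsScalarTower k Bᵐᵒᵖ U]
variable {K P X : Type u} [AddCommGroup K] [Module (A ⊗[k] B) K] [AddCommGroup P]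
  [Module (A ⊗[k] B) P] [AddCommGroup X] [Module (A ⊗[k] B) X]

namespace RTensor

variable (k A B X) in
/-- The functor `- ⊗_B X` preserves injective maps of finite-dimensional right `B`-modules. -/
def IsFlat : Prop :=
  ∀ (V W : Type u) [AddCommGroup V] [Module k V] [Module Bᵐᵒᵖ V] [IsScalarTower k Bᵐᵒᵖ V]
    [AddCommGroup W] [Module k W] [Module Bᵐᵒᵖ W] [IsScalarTower k Bᵐᵒᵖ W]
    [FiniteDimensional k V] [FiniteDimensional k W] (f : V →ₗ[Bᵐᵒᵖ] W), Function.Injective f →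
    Function.Injective (mapLeft (k := k) A X f)

/-- A four lemma chase; projectivity of `P` makes `V ⊗ P → W ⊗ P` injective. -/
theorem map_injective_of_extension [Module.Projective (A ⊗[k] B) P] {ι : K →ₗ[A ⊗[k] B] P}
    {f : V →ₗ[Bᵐᵒᵖ] W} {g : W →ₗ[Bᵐᵒᵖ] U} (hf : Function.Injective f) (hfg : Function.Exact f g)
    (hg : Function.Surjective g) (hV : Function.Injective (map V ι))
    (hU : Function.Injective (map U ι)) : Function.Injective (map W ι) := by
  rw [injective_iff_map_eq_zero]
  intro z hz
  have h1 : mapLeft A K g z = 0 := hU (by rw [← mapLeft_map, hz, map_zero, map_zero])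
  obtain ⟨y, rfl⟩ := (mapLeft_exact hfg hg z).1 h1
  rw [← mapLeft_map] at hz
  have h2 : map V ι y = 0 := mapLeft_injective_of_projective hf (hz.trans (map_zero _).symm)
  rw [hV (h2.trans (map_zero _).symm), map_zero]

theorem map_injective_of_simple [Module.Projective (A ⊗[k] B) P] {ι : K →ₗ[A ⊗[k] B] P}
    (hS : ∀ (V : Type u) [AddCommGroup V] [Module k V] [Module Bᵐᵒᵖ V] [IsScalarTower k Bᵐᵒᵖ V]
      [FiniteDimensional k V] [IsSimpleModule Bᵐᵒᵖ V], Function.Injective (map V ι)) (n : ℕ) :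
    ∀ (V : Type u) [AddCommGroup V] [Module k V] [Module Bᵐᵒᵖ V] [IsScalarTower k Bᵐᵒᵖ V]
      [FiniteDimensional k V], Module.finrank k V = n → Function.Injective (map V ι) := by
  induction n using Nat.strong_induction_on with
  | _ n ih =>
    intro V _ _ _ _ _ hn
    rcases subsingleton_or_nontrivial V with hV | hV
    · rw [injective_iff_map_eq_zero]
      intro z _
      rw [← mapLeft_id z, Subsingleton.elim (LinearMap.id : V →ₗ[Bᵐᵒᵖ] V) 0, mapLeft_zero]
    by_cases hV' : IsSimpleModule Bᵐᵒᵖ V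
    · exact hS V
    obtain ⟨N, hN0, hN1⟩ : ∃ N : Submodule Bᵐᵒᵖ V, N ≠ ⊥ ∧ N ≠ ⊤ := by
      by_contra! h
      exact hV' { exists_pair_ne := ⟨⊥, ⊤, bot_ne_top⟩
                  eq_bot_or_eq_top := fun N => or_iff_not_imp_left.2 (h N) }
    have : FiniteDimensional k N := inferInstanceAs (FiniteDimensional k (N.restrictScalars k))
    have : FiniteDimensional k (V ⧸ N) :=
      Module.Finite.of_surjective (N.mkQ.restrictScalars k) N.mkQ_surjective
    have hlt : Module.finrank k N < n := hn ▸ Submodule.finrank_lt (s := N.restrictScalars k)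
      (fun h => hN1 ((Submodule.restrictScalars_eq_top_iff k Bᵐᵒᵖ V).1 h))
    have hlt' : Module.finrank k (V ⧸ N) < n := by
      have h1 := Submodule.finrank_quotient_add_finrank (N.restrictScalars k)
      have h2 : Module.finrank k (V ⧸ N) = Module.finrank k (V ⧸ N.restrictScalars k) := rfl
      have h3 : 0 < Module.finrank k (N.restrictScalars k) := by
        rw [Module.finrank_pos_iff, Submodule.nontrivial_iff_ne_bot]
        exact fun h => hN0 ((Submodule.restrictScalars_eq_bot_iff k Bᵐᵒᵖ V).1 h)
      omega
    exact map_injective_of_extension (f := N.subtype) (g := N.mkQ) N.subtype_injective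
      (LinearMap.exact_subtype_mkQ N) N.mkQ_surjective (ih _ hlt N rfl) (ih _ hlt' (V ⧸ N) rfl)

/-- The hypothesis plays the role of `Tor_1(-, X) = 0`. An element killed in `W ⊗ X` lifts to `V ⊗
P`, with image in `W ⊗ P` coming from `W ⊗ K`; injectivity for `W / V` moves that preimage to `V ⊗
K`. -/
theorem isFlat_of_map_injective [Module.Projective (A ⊗[k] B) P] {ι : K →ₗ[A ⊗[k] B] P}
    {π : P →ₗ[A ⊗[k] B] X} (hex : Function.Exact ι π) (hπ : Function.Surjective π)
    (h : ∀ (V : Type u) [AddCommGroup V] [Module k V] [Module Bᵐᵒᵖ V] [IsScalarTower k Bᵐᵒᵖ V]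
      [FiniteDimensional k V], Function.Injective (map V ι)) : IsFlat k A B X := by
  intro V W _ _ _ _ _ _ _ _ _ _ f hf
  rw [injective_iff_map_eq_zero]
  intro z hz
  obtain ⟨p, rfl⟩ := TensorOver.map_surjective (S := A) (M := Ind k A V) hπ z
  rw [mapLeft_map] at hz
  obtain ⟨y, hy⟩ := (TensorOver.map_exact (S := A) (M := Ind k A W) hex hπ _).1 hz
  have hfg := LinearMap.exact_map_mkQ_range f
  have hg := (LinearMap.range f).mkQ_surjective
  have : FiniteDimensional k (W ⧸ LinearMap.range f) :=
    Module.Finite.of_surjective ((LinearMap.range f).mkQ.restrictScalars k) hg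
  have h1 : mapLeft A K (LinearMap.range f).mkQ y = 0 := h _ (by
    rw [← mapLeft_map, hy, map_zero, (mapLeft_exact hfg hg).apply_apply_eq_zero])
  obtain ⟨w, rfl⟩ := (mapLeft_exact hfg hg y).1 h1
  rw [← mapLeft_map] at hy
  rw [← mapLeft_injective_of_projective hf hy,
    (TensorOver.map_exact (S := A) (M := Ind k A V) hex hπ).apply_apply_eq_zero]

variable (k A B) in
/-- The identification of `A ⊗_k B` with itself, with the right factor seen as a right module. -/
def indOp : Ind k A Bᵐᵒᵖ →+ A ⊗[k] B :=
  (TensorProduct.map LinearMap.id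
    (MulOpposite.opLinearEquiv k).symm.toLinearMap : A ⊗[k] Bᵐᵒᵖ →ₗ[k] A ⊗[k] B).toAddMonoidHom.comp
    (Ind.equiv k A Bᵐᵒᵖ).toLinearMap.toAddMonoidHom

theorem indOp_tmul (a : A) (b : Bᵐᵒᵖ) : indOp k A B (Ind.tmul k a b) = a ⊗ₜ b.unop := rfl

theorem indOp_smul (a : A) (m : Ind k A Bᵐᵒᵖ) :
    indOp k A B (a • m) = (a ⊗ₜ 1) * indOp k A B m := by
  induction m using Ind.induction_on with
  | zero => simp
  | tmul a' b => simp [Ind.smul_tmul, indOp_tmul]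
  | add x y hx hy => rw [smul_add, map_add, map_add, hx, hy, mul_add]

theorem indOp_op_smul (r : A ⊗[k] B) (m : Ind k A Bᵐᵒᵖ) :
    indOp k A B (MulOpposite.op r • m) = indOp k A B m * r := by
  induction r with
  | zero => simp
  | add x y hx hy => rw [MulOpposite.op_add, add_smul, map_add, hx, hy, mul_add]
  | tmul a b =>
    induction m using Ind.induction_on with
    | zero => simp
    | tmul a' b' => simp [Ind.op_smul_tmul', indOp_tmul]
    | add x y hx hy => rw [smul_add, map_add, map_add, hx, hy, add_mul]

theorem indOp_injective : Function.Injective (indOp k A B) :=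
  (TensorProduct.congr (LinearEquiv.refl k A) (MulOpposite.opLinearEquiv k).symm).injective

/-- The `A`-module structure on an `A ⊗_k B`-module. -/
abbrev leftModule (k A B X : Type u) [Field k] [Ring A] [Algebra k A] [Ring B] [Algebra k B]
    [AddCommGroup X] [Module (A ⊗[k] B) X] : Module A X :=
  Module.compHom X (Algebra.TensorProduct.includeLeftRingHom : A →+* A ⊗[k] B)

theorem eq_zero_of_tmk_one {x : X}
    (hx : TensorOver.tmk A (A ⊗[k] B) (Ind.tmul k (1 : A) (1 : Bᵐᵒᵖ)) x = 0) : x = 0 := by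
  let : Module A X := leftModule k A B X
  let γ : RTensor k A B Bᵐᵒᵖ X →ₗ[A] X := TensorOver.lift
    ((smulAddHom (A ⊗[k] B) X).comp (indOp k A B))
    (fun s m x => by
      rw [AddMonoidHom.comp_apply, indOp_smul]
      exact mul_smul _ _ _)
    (fun r m x => by
      rw [AddMonoidHom.comp_apply, indOp_op_smul]
      exact mul_smul _ _ _)
  have h1 : γ (TensorOver.tmk A (A ⊗[k] B) (Ind.tmul k 1 1) x) = x := one_smul (A ⊗[k] B) x
  rw [hx, map_zero] at h1
  exact h1.symm

theorem injective_of_map_op_injective {ι : K →ₗ[A ⊗[k] B] P}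
    (h : Function.Injective (map Bᵐᵒᵖ ι)) : Function.Injective ι := by
  rw [injective_iff_map_eq_zero]
  intro x hx
  refine eq_zero_of_tmk_one (k := k) (A := A) (B := B) (h ?_)
  rw [TensorOver.map_tmk, hx, map_zero]
  exact (TensorOver.tmkAddHom A (A ⊗[k] B) (Ind.tmul k 1 1)).map_zero

theorem map_op_injective {ι : K →ₗ[A ⊗[k] B] P} (hι : Function.Injective ι) :
    Function.Injective (map Bᵐᵒᵖ ι) := by
  have hK : ∀ z : RTensor k A B Bᵐᵒᵖ K, ∃ x : K,
      z = TensorOver.tmk A (A ⊗[k] B) (Ind.tmul k 1 1) x := fun z => by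
    induction z using RTensor.induction_on with
    | zero => exact ⟨0, (TensorOver.tmkAddHom A (A ⊗[k] B) (Ind.tmul k 1 1)).map_zero.symm⟩
    | tmk v x =>
      refine ⟨((1 : A) ⊗ₜ[k] v.unop) • x, ?_⟩
      rw [← TensorOver.op_smul_tmk]
      congr 1
      apply indOp_injective
      rw [indOp_op_smul]
      simp [indOp_tmul]
    | add a b ha hb =>
      obtain ⟨x, rfl⟩ := ha
      obtain ⟨y, rfl⟩ := hb
      exact ⟨x + y, (TensorOver.tmk_add _ _ _).symm⟩
  rw [injective_iff_map_eq_zero]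
  intro z hz
  obtain ⟨x, rfl⟩ := hK z
  rw [TensorOver.map_tmk] at hz
  rw [hι ((eq_zero_of_tmk_one hz).trans (map_zero ι).symm)]
  exact (TensorOver.tmkAddHom A (A ⊗[k] B) (Ind.tmul k 1 1)).map_zero

variable (A X V) in
theorem sum_mapLeft_single_proj {n : ℕ} (z : RTensor k A B (Fin n → V) X) :
    ∑ i, mapLeft A X (LinearMap.single Bᵐᵒᵖ (fun _ : Fin n => V) i)
      (mapLeft A X (LinearMap.proj i : (Fin n → V) →ₗ[Bᵐᵒᵖ] V) z) = z := by
  simp only [mapLeft_mapLeft]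
  rw [← mapLeft_sum]
  have : ∑ i, LinearMap.single Bᵐᵒᵖ (fun _ : Fin n => V) i ∘ₗ
      (LinearMap.proj i : (Fin n → V) →ₗ[Bᵐᵒᵖ] V) = LinearMap.id := by
    ext f j
    simp [Finset.sum_apply, Pi.single_apply]
  rw [this, mapLeft_id]

theorem map_pi_injective {ι : K →ₗ[A ⊗[k] B] P} (h : Function.Injective (map V ι)) (n : ℕ) :
    Function.Injective (map (Fin n → V) ι) := by
  rw [injective_iff_map_eq_zero]
  intro z hz
  rw [← sum_mapLeft_single_proj A V K z]
  refine Finset.sum_eq_zero fun i _ => ?_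
  have : mapLeft A K (LinearMap.proj i : (Fin n → V) →ₗ[Bᵐᵒᵖ] V) z = 0 :=
    h (by rw [← mapLeft_map, hz, map_zero, map_zero])
  rw [this, map_zero]

/-- Balancing of `Tor_1`: resolve `V` by `B^n` instead of `X` by `P`. Flatness of `X` is applied to
the kernel of `B^n → V`, which is finite-dimensional because `B` is. -/
theorem IsFlat.map_injective [FiniteDimensional k B] [FiniteDimensional k V]
    (hX : IsFlat k A B X) {ι : K →ₗ[A ⊗[k] B] P} {π : P →ₗ[A ⊗[k] B] X}
    (hι : Function.Injective ι) (hex : Function.Exact ι π) (hπ : Function.Surjective π) :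
    Function.Injective (map V ι) := by
  have : Module.Finite Bᵐᵒᵖ V := Module.Finite.of_restrictScalars_finite k _ _
  obtain ⟨n, g, hg⟩ := Module.Finite.exists_fin' Bᵐᵒᵖ V
  have : FiniteDimensional k Bᵐᵒᵖ := Module.Finite.equiv (MulOpposite.opLinearEquiv k)
  have : FiniteDimensional k (LinearMap.ker g) :=
    inferInstanceAs (FiniteDimensional k ((LinearMap.ker g).restrictScalars k))
  have hfg := LinearMap.exact_subtype_ker_map g
  rw [injective_iff_map_eq_zero]
  intro z hz
  obtain ⟨y, rfl⟩ := mapLeft_surjective hg z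
  rw [← mapLeft_map] at hz
  obtain ⟨p, hp⟩ := (mapLeft_exact hfg hg _).1 hz
  have h1 : map _ π p = 0 := hX _ _ _ (LinearMap.ker g).subtype_injective (by
    rw [mapLeft_map, hp, map_zero,
      (TensorOver.map_exact (S := A) (M := Ind k A (Fin n → Bᵐᵒᵖ)) hex hπ).apply_apply_eq_zero])
  obtain ⟨w, rfl⟩ := (TensorOver.map_exact (S := A)
    (M := Ind k A (LinearMap.ker g)) hex hπ p).1 h1
  rw [mapLeft_map] at hp
  rw [← map_pi_injective (map_op_injective hι) n hp, (mapLeft_exact hfg hg).apply_apply_eq_zero]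

/-- `V ⊗ K → W ⊗ K → W ⊗ P` equals `V ⊗ K → V ⊗ P → W ⊗ P`, a composite of injections. -/
theorem IsFlat.syzygy [FiniteDimensional k B] [Module.Projective (A ⊗[k] B) P]
    (hX : IsFlat k A B X) {ι : K →ₗ[A ⊗[k] B] P} {π : P →ₗ[A ⊗[k] B] X}
    (hι : Function.Injective ι) (hex : Function.Exact ι π) (hπ : Function.Surjective π) :
    IsFlat k A B K := by
  intro V W _ _ _ _ _ _ _ _ _ _ f hf
  have h : Function.Injective (map W ι ∘ mapLeft (k := k) A K f) := by
    have : map W ι ∘ mapLeft (k := k) A K f = mapLeft A P f ∘ map V ι :=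
      funext fun z => (mapLeft_map f ι z).symm
    rw [this]
    exact (mapLeft_injective_of_projective hf).comp (hX.map_injective hι hex hπ)
  exact h.of_comp

end RTensor

end Flat

/-! ### The duality `Hom_Λ(X, Λ) ≅ Hom_A(D(B) ⊗_B X, A)`. -/

section Duality

variable {k A B : Type u} [Field k] [Ring A] [Algebra k A] [Ring B] [Algebra k B]
  [FiniteDimensional k B]

variable (k A B) in
/-- The isomorphism `A ⊗_k B ≅ Hom_k(D(B), A)`, `a ⊗ b ↦ (f ↦ f(b) a)`. -/
def dualPairing : A ⊗[k] B ≃ₗ[k] (Module.Dual k B →ₗ[k] A) :=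
  TensorProduct.comm k A B ≪≫ₗ
    TensorProduct.congr (Module.evalEquiv k B) (LinearEquiv.refl k A) ≪≫ₗ
      dualTensorHomEquiv k (Module.Dual k B) A

theorem dualPairing_tmul (a : A) (b : B) (f : Module.Dual k B) :
    dualPairing k A B (a ⊗ₜ b) f = f b • a := by
  simp [dualPairing]

theorem dualPairing_mul (a : A) (b : B) (t : A ⊗[k] B) (f : RightDual k B) :
    dualPairing k A B ((a ⊗ₜ b) * t) (RightDual.equiv k B f) =
      a * dualPairing k A B t (RightDual.equiv k B (MulOpposite.op b • f)) := by
  induction t with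
  | zero => simp
  | tmul a' b' =>
    rw [Algebra.TensorProduct.tmul_mul_tmul, dualPairing_tmul, dualPairing_tmul,
      RightDual.smul_apply, smul_eq_mul, mul_smul_comm]
  | add x y hx hy => simp only [mul_add, map_add, LinearMap.add_apply, hx, hy]

/-- The pairing `(a ⊗ f, t) ↦ a · t(f)`, for `t` in `A ⊗_k B ≅ Hom_k(D(B), A)`. -/
def evalAux (t : A ⊗[k] B) : Ind k A (RightDual k B) →+ A :=
  (TensorProduct.lift ((LinearMap.mul k A).compl₂
    (dualPairing k A B t ∘ₗ (RightDual.equiv k B).toLinearMap))).toAddMonoidHom.comp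
      (Ind.equiv k A (RightDual k B)).toLinearMap.toAddMonoidHom

theorem evalAux_tmul (t : A ⊗[k] B) (a : A) (f : RightDual k B) :
    evalAux t (Ind.tmul k a f) = a * dualPairing k A B t (RightDual.equiv k B f) := rfl

theorem evalAux_add (s t : A ⊗[k] B) (m : Ind k A (RightDual k B)) :
    evalAux (s + t) m = evalAux s m + evalAux t m := by
  induction m using Ind.induction_on with
  | zero => simp
  | tmul a f => simp only [evalAux_tmul, map_add, LinearMap.add_apply, mul_add]
  | add x y hx hy => simp only [map_add, hx, hy]; abel

theorem evalAux_smul (t : A ⊗[k] B) (a : A) (m : Ind k A (RightDual k B)) :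
    evalAux t (a • m) = a • evalAux t m := by
  induction m using Ind.induction_on with
  | zero => simp
  | tmul a' f => simp only [Ind.smul_tmul, evalAux_tmul, smul_eq_mul, mul_assoc]
  | add x y hx hy => simp only [smul_add, map_add, hx, hy]

theorem evalAux_op_smul (r t : A ⊗[k] B) (m : Ind k A (RightDual k B)) :
    evalAux t (MulOpposite.op r • m) = evalAux (r * t) m := by
  induction r with
  | zero =>
    rw [MulOpposite.op_zero, zero_smul, map_zero, zero_mul]
    exact (add_eq_left.1 ((evalAux_add 0 0 m).symm.trans (by rw [add_zero]))).symm
  | add x y hx hy => rw [MulOpposite.op_add, add_smul, map_add, hx, hy, add_mul, evalAux_add]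
  | tmul a b =>
    induction m using Ind.induction_on with
    | zero => simp
    | tmul a' f => rw [Ind.op_smul_tmul', evalAux_tmul, evalAux_tmul, dualPairing_mul, mul_assoc]
    | add x y hx hy => rw [smul_add, map_add, map_add, hx, hy]

variable (k A B) in
/-- The map `D(B) ⊗_B (A ⊗_k B) ⟶ A`. -/
def evalMap : RTensor k A B (RightDual k B) (A ⊗[k] B) →ₗ[A] A :=
  TensorOver.lift (AddMonoidHom.mk' (evalAux (k := k) (A := A) (B := B)) fun s t => by
      ext m; exact evalAux_add s t m).flip
    (fun s m x => evalAux_smul _ _ _)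
    (fun r m x => evalAux_op_smul _ _ _)

variable {X Y : Type u} [AddCommGroup X] [Module (A ⊗[k] B) X] [AddCommGroup Y]
  [Module (A ⊗[k] B) Y]

theorem evalMap_map_tmk (ψ : X →ₗ[A ⊗[k] B] A ⊗[k] B) (a : A) (f : RightDual k B) (x : X) :
    evalMap k A B (RTensor.map _ ψ (TensorOver.tmk A (A ⊗[k] B) (Ind.tmul k a f) x)) =
      a * dualPairing k A B (ψ x) (RightDual.equiv k B f) := rfl

/-- The composite on `1 ⊗ f ⊗ x` is the value of `ψ x` at `f` under `Λ ≅ Hom_k(D(B), A)`, so it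
determines `ψ`. -/
theorem evalMap_map_injective {ψ ψ' : X →ₗ[A ⊗[k] B] A ⊗[k] B}
    (h : evalMap k A B ∘ₗ RTensor.map _ ψ = evalMap k A B ∘ₗ RTensor.map _ ψ') : ψ = ψ' := by
  ext x
  apply (dualPairing k A B).injective
  ext f
  have := LinearMap.congr_fun h
    (TensorOver.tmk A (A ⊗[k] B) (Ind.tmul k 1 ((RightDual.equiv k B).symm f)) x)
  rw [LinearMap.comp_apply, LinearMap.comp_apply, evalMap_map_tmk, evalMap_map_tmk, one_mul,
    one_mul] at this
  exact this

/-- Let `ψ x` correspond to `f ↦ φ (1 ⊗ f ⊗ x)` in `Hom_k(D(B), A)`; balancing and `A`-linearity of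
`φ` make `ψ` linear over `Λ`. -/
theorem exists_eq_evalMap_map (φ : RTensor k A B (RightDual k B) X →ₗ[A] A) :
    ∃ ψ : X →ₗ[A ⊗[k] B] A ⊗[k] B, φ = evalMap k A B ∘ₗ RTensor.map _ ψ := by
  let Φ : X → (Module.Dual k B →ₗ[k] A) := fun x =>
    { toFun := fun f => φ (TensorOver.tmk A (A ⊗[k] B)
        (Ind.tmul k 1 ((RightDual.equiv k B).symm f)) x)
      map_add' := fun f g => by rw [map_add, Ind.tmul_add, TensorOver.add_tmk, map_add]
      map_smul' := fun c f => by
        rw [map_smul, Ind.tmul_smul, RingHom.id_apply, ← mul_one (c • (1 : A)), ← Ind.smul_tmul,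
          ← TensorOver.smul_tmk, map_smul, smul_eq_mul, smul_mul_assoc, one_mul] }
  have hΦ : ∀ x f, φ (TensorOver.tmk A (A ⊗[k] B) (Ind.tmul k 1 f) x) =
    Φ x (RightDual.equiv k B f) := fun x f => rfl
  have hadd : ∀ x y, Φ (x + y) = Φ x + Φ y := fun x y => by
    ext f
    change φ _ = φ _ + φ _
    rw [TensorOver.tmk_add, map_add]
  let ψ : X →+ A ⊗[k] B := AddMonoidHom.mk' (fun x => (dualPairing k A B).symm (Φ x))
    fun x y => by rw [hadd, map_add]
  have hψ : ∀ x, dualPairing k A B (ψ x) = Φ x := fun x => LinearEquiv.apply_symm_apply _ _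
  refine ⟨{ ψ with map_smul' := fun r x => ?_ }, TensorOver.ext_tmk fun m x => ?_⟩
  · change ψ (r • x) = r • ψ x
    induction r with
    | zero => simp
    | add r s hr hs => rw [add_smul, map_add, hr, hs, add_smul]
    | tmul a b =>
      apply (dualPairing k A B).injective
      refine LinearMap.ext fun f => ?_
      obtain ⟨f, rfl⟩ := (RightDual.equiv k B).surjective f
      rw [smul_eq_mul, dualPairing_mul, hψ, hψ, ← hΦ,
        ← hΦ, ← TensorOver.op_smul_tmk, Ind.op_smul_tmul', one_mul, ← smul_eq_mul, ← map_smul φ,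
        TensorOver.smul_tmk, Ind.smul_tmul, mul_one]
  · rw [LinearMap.comp_apply]
    induction m using Ind.induction_on with
    | zero =>
      rw [show TensorOver.tmk A (A ⊗[k] B) (0 : Ind k A (RightDual k B)) x = 0 from
        (TensorOver.tmkHom A (A ⊗[k] B) x).map_zero, map_zero, map_zero, map_zero]
    | add m n hm hn => rw [TensorOver.add_tmk, map_add, map_add, map_add, hm, hn]
    | tmul a f =>
      rw [evalMap_map_tmk]
      change _ = a * dualPairing k A B (ψ x) (RightDual.equiv k B f)
      rw [hψ, ← hΦ, ← smul_eq_mul, ← map_smul φ, TensorOver.smul_tmk, Ind.smul_tmul,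
        mul_one]

end Duality

/-- Each coordinate functional `λ` of a basis induces the `B`-linear map `v ↦ (c ↦ λ (v c))` to
`D(B)`; evaluation at `c = 1` recovers the coordinate. -/
theorem exists_embedding {k B : Type u} [Field k] [Ring B] [Algebra k B] (V : Type u) [AddCommGroup V] [Module k V] [Module Bᵐᵒᵖ V]
    [IsScalarTower k Bᵐᵒᵖ V] [FiniteDimensional k V] :
    ∃ (n : ℕ) (f : V →ₗ[Bᵐᵒᵖ] (Fin n → RightDual k B)), Function.Injective f := by
  let b := Module.finBasis k V
  refine ⟨_, LinearMap.pi fun i : Fin (Module.finrank k V) =>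
    { toFun := fun v => (RightDual.equiv k B).symm
        { toFun := fun c => b.coord i (MulOpposite.op c • v)
          map_add' := fun c d => by rw [MulOpposite.op_add, add_smul, map_add]
          map_smul' := fun c d => by
            rw [MulOpposite.op_smul, smul_assoc, map_smul, RingHom.id_apply] }
      map_add' := fun v w => (RightDual.equiv k B).injective (LinearMap.ext fun c => by
        change b.coord i (MulOpposite.op c • (v + w)) =
          b.coord i (MulOpposite.op c • v) + b.coord i (MulOpposite.op c • w)
        rw [smul_add, map_add])
      map_smul' := fun r v => (RightDual.equiv k B).injective (LinearMap.ext fun c =>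
        congrArg (b.coord i) (mul_smul (MulOpposite.op c) r v).symm) }, ?_⟩
  intro v w h
  refine b.ext_elem fun i => ?_
  have := LinearMap.congr_fun (congrArg (RightDual.equiv k B) (congrFun h i)) (1 : B)
  change b.coord i ((1 : Bᵐᵒᵖ) • v) = b.coord i ((1 : Bᵐᵒᵖ) • w) at this
  rwa [one_smul, one_smul] at this

/-! ### The class `IsFlatGproj`, its syzygies and cosyzygies, and the conclusion. -/

section Main

variable {k A B : Type u} [Field k] [Ring A] [Algebra k A] [Ring B] [Algebra k B]

open RTensor

/-- By dévissage only simple `V` matter, and such a `V` is `D(S)` for the simple left module `S =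
D(V)`. -/
theorem map_injective_of_mon {P : Type u} [AddCommGroup P] [Module (A ⊗[k] B) P]
    [Module.Projective (A ⊗[k] B) P] {K : Type u} [AddCommGroup K] [Module (A ⊗[k] B) K]
    {ι : K →ₗ[A ⊗[k] B] P}
    (hS : ∀ (S : Type u) [AddCommGroup S] [Module k S] [Module B S] [IsScalarTower k B S]
      [IsSimpleModule B S], Function.Injective
        (TensorOver.map A (A ⊗[k] B) (Ind k A (RightDual k S)) ι))
    (V : Type u) [AddCommGroup V] [Module k V] [Module Bᵐᵒᵖ V] [IsScalarTower k Bᵐᵒᵖ V]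
    [FiniteDimensional k V] : Function.Injective (RTensor.map V ι) := by
  refine map_injective_of_simple (fun V _ _ _ _ _ _ => ?_) _ V rfl
  have := LeftDual.isSimpleModule (k := k) (B := B) (V := V)
  let e := LeftDual.evalEquiv k B V
  rw [injective_iff_map_eq_zero]
  intro z hz
  have h1 : mapLeft A K e.toLinearMap z = 0 := hS (LeftDual k V) (by
    refine (mapLeft_map e.toLinearMap ι z).symm.trans ?_
    rw [hz, map_zero, map_zero])
  rw [← mapLeft_id z, ← e.symm_comp, ← mapLeft_mapLeft, h1, map_zero]

theorem isFlat_of_mon {X : ModuleCat.{u} (A ⊗[k] B)} (hX : Mon k A B X) : IsFlat k A B X := by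
  obtain ⟨P, p, _, hp, h⟩ := exists_projective_tor_one X
  exact isFlat_of_map_injective (LinearMap.exact_subtype_ker_map p) hp fun V _ _ _ _ _ =>
    map_injective_of_mon (fun S _ _ _ _ _ => h _ _ (hX.2 S 1 le_rfl)) V

variable (k A B) in
/-- The finitely generated modules `X`, flat over `B`, such that `V ⊗_B X` is Gorenstein projective
for every finite-dimensional right `B`-module `V`. -/
structure IsFlatGproj (X : Type u) [AddCommGroup X] [Module (A ⊗[k] B) X] : Prop where
  finite : Module.Finite (A ⊗[k] B) X
  flat : IsFlat k A B X
  gproj : ∀ (V : Type u) [AddCommGroup V] [Module k V] [Module Bᵐᵒᵖ V] [IsScalarTower k Bᵐᵒᵖ V]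
    [FiniteDimensional k V], Gproj A (ModuleCat.of A (RTensor k A B V X))

namespace IsFlatGproj

variable [FiniteDimensional k B]
variable {K P X Y : Type u} [AddCommGroup K] [Module (A ⊗[k] B) K] [AddCommGroup P]
  [Module (A ⊗[k] B) P] [AddCommGroup X] [Module (A ⊗[k] B) X] [AddCommGroup Y]
  [Module (A ⊗[k] B) Y]

/-- Transpose `φ` to `D(B) ⊗_B K → A`, extend it to `D(B) ⊗_B P` by `Ext^1_A(D(B) ⊗_B X, A) = 0`,
and transpose back. -/
theorem exists_extension (hX : IsFlatGproj k A B X) {ι : K →ₗ[A ⊗[k] B] P}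
    {π : P →ₗ[A ⊗[k] B] X} (hι : Function.Injective ι) (hex : Function.Exact ι π)
    (hπ : Function.Surjective π) (φ : K →ₗ[A ⊗[k] B] A ⊗[k] B) :
    ∃ ψ : P →ₗ[A ⊗[k] B] A ⊗[k] B, ψ ∘ₗ ι = φ := by
  have : FiniteDimensional k (RightDual k B) :=
    inferInstanceAs (FiniteDimensional k (Module.Dual k B))
  obtain ⟨θ, hθ⟩ := exists_extension_of_ext_one
    (gproj_extVanishing (hX.gproj (RightDual k B)) 0)
    (hX.flat.map_injective (V := RightDual k B) hι hex hπ) (TensorOver.map_exact hex hπ)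
    (TensorOver.map_surjective hπ) (evalMap k A B ∘ₗ RTensor.map _ φ)
  obtain ⟨ψ, rfl⟩ := exists_eq_evalMap_map θ
  refine ⟨ψ, evalMap_map_injective ?_⟩
  rw [← hθ]
  refine LinearMap.ext fun z => ?_
  simp only [LinearMap.comp_apply, TensorOver.map_comp_apply]

theorem syzygy [FiniteDimensional k A] [Module.Finite (A ⊗[k] B) P]
    [Module.Projective (A ⊗[k] B) P]
    (hX : IsFlatGproj k A B X) {ι : K →ₗ[A ⊗[k] B] P}
    {π : P →ₗ[A ⊗[k] B] X} (hι : Function.Injective ι) (hex : Function.Exact ι π)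
    (hπ : Function.Surjective π) : IsFlatGproj k A B K where
  finite :=
    have : IsNoetherianRing (A ⊗[k] B) := IsNoetherianRing.of_finite k _
    Module.Finite.of_injective ι hι
  flat := hX.flat.syzygy hι hex hπ
  gproj V _ _ _ _ _ :=
    have : IsNoetherianRing A := IsNoetherianRing.of_finite k _
    have : Module.Projective A (RTensor k A B V P) := TensorOver.projective_of_projective
    have : Module.Finite A (RTensor k A B V P) := TensorOver.finite
    gproj_syzygy (hX.flat.map_injective (V := V) hι hex hπ) (TensorOver.map_exact hex hπ)
      (TensorOver.map_surjective hπ) (hX.gproj V)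

theorem extVanishing [FiniteDimensional k A] (hX : IsFlatGproj k A B X) : ExtVanishing (A ⊗[k] B) X := by
  intro n
  induction n generalizing X with
  | zero =>
    have := hX.finite
    obtain ⟨n, f, hf⟩ := Module.Finite.exists_fin' (A ⊗[k] B) X
    exact ext_one_of_exists_extension (LinearMap.ker f).subtype_injective
      (LinearMap.exact_subtype_ker_map f) hf (hX.exists_extension
        (LinearMap.ker f).subtype_injective (LinearMap.exact_subtype_ker_map f) hf)
  | succ n ih =>
    have := hX.finite
    obtain ⟨n, f, hf⟩ := Module.Finite.exists_fin' (A ⊗[k] B) X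
    have hex := LinearMap.exact_subtype_ker_map f
    exact ext_succ_of_syzygy (LinearMap.ker f).subtype_injective hex hf
      (ih (hX.syzygy (LinearMap.ker f).subtype_injective hex hf))

theorem exists_approximation [FiniteDimensional k A] (hX : IsFlatGproj k A B X) :
    ∃ (n : ℕ) (q : X →ₗ[A ⊗[k] B] (Fin n → A ⊗[k] B)), ∀ φ : X →ₗ[A ⊗[k] B] A ⊗[k] B,
      ∃ ψ : (Fin n → A ⊗[k] B) →ₗ[A ⊗[k] B] A ⊗[k] B, ψ ∘ₗ q = φ := by
  have := hX.finite
  obtain ⟨m, f, hf⟩ := Module.Finite.exists_fin' (A ⊗[k] B) X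
  let j : (X →ₗ[A ⊗[k] B] A ⊗[k] B) →ₗ[k] (Fin m → A ⊗[k] B) :=
    { toFun := fun φ i => φ (f (Pi.single i 1))
      map_add' := fun _ _ => rfl
      map_smul' := fun _ _ => rfl }
  have hj : Function.Injective j := fun φ ψ h => by
    have : φ ∘ₗ f = ψ ∘ₗ f := by
      ext i
      exact congrFun h i
    ext x
    obtain ⟨y, rfl⟩ := hf x
    exact LinearMap.congr_fun this y
  have : FiniteDimensional k (X →ₗ[A ⊗[k] B] A ⊗[k] B) := Module.Finite.of_injective j hj
  let b := Module.finBasis k (X →ₗ[A ⊗[k] B] A ⊗[k] B)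
  -- The components of `q` form a `k`-basis of `Hom_Λ(X, Λ)`, so every `φ` is a `k`-combination of
  -- them.
  refine ⟨_, LinearMap.pi b, fun φ => ⟨∑ i, b.repr φ i • LinearMap.proj i, ?_⟩⟩
  ext x
  have h := LinearMap.congr_fun (b.sum_repr φ) x
  simp only [LinearMap.sum_apply, LinearMap.smul_apply] at h
  refine Eq.trans ?_ h
  simp

theorem exists_factorization (hX : IsFlatGproj k A B X) {q : X →ₗ[A ⊗[k] B] Y}
    (hq : ∀ φ : X →ₗ[A ⊗[k] B] A ⊗[k] B, ∃ ψ : Y →ₗ[A ⊗[k] B] A ⊗[k] B, ψ ∘ₗ q = φ)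
    (V : Type u) [AddCommGroup V] [Module k V] [Module Bᵐᵒᵖ V] [IsScalarTower k Bᵐᵒᵖ V]
    [FiniteDimensional k V] (φ : RTensor k A B V X →ₗ[A] A) :
    ∃ ψ : RTensor k A B V Y →ₗ[A] A, ψ ∘ₗ RTensor.map V q = φ := by
  have : FiniteDimensional k (RightDual k B) :=
    inferInstanceAs (FiniteDimensional k (Module.Dual k B))
  obtain ⟨n, f, hf⟩ := exists_embedding (k := k) (B := B) V
  have hfg := LinearMap.exact_map_mkQ_range f
  have hg := (LinearMap.range f).mkQ_surjective
  have : FiniteDimensional k ((Fin n → RightDual k B) ⧸ LinearMap.range f) :=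
    Module.Finite.of_surjective ((LinearMap.range f).mkQ.restrictScalars k) hg
  -- With `V` embedded in `D(B)^n` with cokernel `U`, flatness and `Ext^1_A(U ⊗_B X, A) = 0` extend
  -- `φ` to `D(B)^n ⊗_B X`. There the duality turns each component into a map `X → Λ`, which factors
  -- through `q`.
  obtain ⟨θ, hθ⟩ := exists_extension_of_ext_one (gproj_extVanishing (hX.gproj _) 0)
    (hX.flat _ _ f hf) (mapLeft_exact hfg hg) (mapLeft_surjective hg) φ
  have hi : ∀ i : Fin n, ∃ η : Y →ₗ[A ⊗[k] B] A ⊗[k] B,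
      evalMap k A B ∘ₗ RTensor.map _ η ∘ₗ RTensor.map _ q =
        θ ∘ₗ mapLeft A X (LinearMap.single Bᵐᵒᵖ (fun _ : Fin n => RightDual k B) i) := fun i => by
    obtain ⟨χ, hχ⟩ := exists_eq_evalMap_map
      (θ ∘ₗ mapLeft A X (LinearMap.single Bᵐᵒᵖ (fun _ : Fin n => RightDual k B) i))
    obtain ⟨η, rfl⟩ := hq χ
    refine ⟨η, ?_⟩
    rw [hχ]
    refine LinearMap.ext fun z => ?_
    simp only [LinearMap.comp_apply, TensorOver.map_comp_apply]
  choose η hη using hi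
  refine ⟨(∑ i, evalMap k A B ∘ₗ RTensor.map _ (η i) ∘ₗ
    mapLeft A Y (LinearMap.proj i : (Fin n → RightDual k B) →ₗ[Bᵐᵒᵖ] _)) ∘ₗ mapLeft A Y f, ?_⟩
  refine LinearMap.ext fun z => ?_
  rw [← hθ, LinearMap.comp_apply, LinearMap.comp_apply, LinearMap.comp_apply,
    ← sum_mapLeft_single_proj A (RightDual k B) X (mapLeft A X f z), map_sum, LinearMap.sum_apply]
  refine Finset.sum_congr rfl fun i _ => ?_
  rw [mapLeft_map, LinearMap.comp_apply, LinearMap.comp_apply, mapLeft_map]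
  exact LinearMap.congr_fun (hη i) _

theorem map_injective (hX : IsFlatGproj k A B X) {q : X →ₗ[A ⊗[k] B] Y}
    (hq : ∀ φ : X →ₗ[A ⊗[k] B] A ⊗[k] B, ∃ ψ : Y →ₗ[A ⊗[k] B] A ⊗[k] B, ψ ∘ₗ q = φ)
    (V : Type u) [AddCommGroup V] [Module k V] [Module Bᵐᵒᵖ V] [IsScalarTower k Bᵐᵒᵖ V]
    [FiniteDimensional k V] : Function.Injective (RTensor.map V q) := by
  rw [injective_iff_map_eq_zero]
  intro z hz
  refine eq_zero_of_gproj (hX.gproj V) fun φ => ?_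
  obtain ⟨ψ, rfl⟩ := hX.exists_factorization hq V φ
  rw [LinearMap.comp_apply, hz, map_zero]

theorem injective (hX : IsFlatGproj k A B X) {q : X →ₗ[A ⊗[k] B] Y}
    (hq : ∀ φ : X →ₗ[A ⊗[k] B] A ⊗[k] B, ∃ ψ : Y →ₗ[A ⊗[k] B] A ⊗[k] B, ψ ∘ₗ q = φ) :
    Function.Injective q :=
  have : FiniteDimensional k Bᵐᵒᵖ := Module.Finite.equiv (MulOpposite.opLinearEquiv k)
  injective_of_map_op_injective (hX.map_injective hq Bᵐᵒᵖ)

/-- Injectivity of every `V ⊗ q` gives flatness of the cokernel. The factorization property of `V ⊗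
q` is exactly what `gproj_cosyzygy` requires for `V ⊗_B Y`. -/
theorem cosyzygy [FiniteDimensional k A] [Module.Finite (A ⊗[k] B) P]
    [Module.Projective (A ⊗[k] B) P]
    (hX : IsFlatGproj k A B X) {q : X →ₗ[A ⊗[k] B] P} {π : P →ₗ[A ⊗[k] B] Y}
    (hq : ∀ φ : X →ₗ[A ⊗[k] B] A ⊗[k] B, ∃ ψ : P →ₗ[A ⊗[k] B] A ⊗[k] B, ψ ∘ₗ q = φ)
    (hex : Function.Exact q π) (hπ : Function.Surjective π) : IsFlatGproj k A B Y where
  finite := Module.Finite.of_surjective π hπ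
  flat := isFlat_of_map_injective hex hπ fun V _ _ _ _ _ => hX.map_injective hq V
  gproj V _ _ _ _ _ :=
    have : IsNoetherianRing A := IsNoetherianRing.of_finite k _
    have : Module.Projective A (RTensor k A B V P) := TensorOver.projective_of_projective
    have : Module.Finite A (RTensor k A B V P) := TensorOver.finite
    gproj_cosyzygy (TensorOver.map_exact hex hπ) (TensorOver.map_surjective hπ) (hX.gproj V)
      (hX.exists_factorization hq V)

theorem isGproj [FiniteDimensional k A] {X : ModuleCat.{u} (A ⊗[k] B)}
    (hX : IsFlatGproj k A B X) :
    Gproj (A ⊗[k] B) X := by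
  have : IsNoetherianRing (A ⊗[k] B) := IsNoetherianRing.of_finite k _
  refine gproj_of_coresolution (fun X => IsFlatGproj k A B X) (fun X hX => ?_) hX
  obtain ⟨n, q, hq⟩ := hX.exists_approximation
  have hex := LinearMap.exact_map_mkQ_range q
  have hπ := (LinearMap.range q).mkQ_surjective
  exact ⟨hX.finite, hX.extVanishing, ModuleCat.of _ (Fin n → A ⊗[k] B),
    ModuleCat.of _ ((Fin n → A ⊗[k] B) ⧸ LinearMap.range q), q, (LinearMap.range q).mkQ,
    inferInstance, inferInstance, hX.injective hq, hex, hπ, hX.cosyzygy hq hex hπ⟩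

end IsFlatGproj

end Main

end MonRep

end

theorem mainTheorem6 (k A B : Type u) [Field k]
    [Ring A] [Algebra k A] [FiniteDimensional k A]
    [Ring B] [Algebra k B] [FiniteDimensional k B] :
    MonRep.MonOver k A B (MonRep.Gproj A) ≤ MonRep.Gproj (A ⊗[k] B) := by
  intro X hX
  refine MonRep.IsFlatGproj.isGproj ⟨hX.1.1, MonRep.isFlat_of_mon hX.1, fun V _ _ _ _ _ => ?_⟩
  have : Module.Finite Bᵐᵒᵖ V := Module.Finite.of_restrictScalars_finite k _ _
  exact hX.2 V
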